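/- Let $G=(V,E)$ be a finite directed graph (loops allowed) with at least two vertices, and write $N^{\mathrm{in}}(v)=\{w:(w,v)\in E\}$, $N^{\mathrm{out}}(v)=\{w:(v,w)\in E\}$. The graph $G$ is \emph{strongly observable} if every $v\in V$ satisfies $v\in N^{\mathrm{in}}(v)$ or $V\setminus\{v\}\subseteq N^{\mathrm{in}}(v)$ (or both). Consider the following $T$-round game on $G$. The adversary fixes loss functions $f_t:V^t\to[0,1]$, $t=1,\dots,T$. In round $t$ the player, who knows $G$ and $T$, picks an action $X_t\in V$ at random, with a distribution depending measurably on the own past actions and on all feedback received before; the player incurs the loss $f_t(X_1,\dots,X_t)$ and receives as feedback exactly the values $f_t(X_1,\dots,X_{t-1},i)$ for $i\in N^{\mathrm{out}}(X_t)$. The adversary has memory bounded by $1$ if each $f_t(x_1,\dots,x_t)$ depends only on $(x_{t-1},x_t)$. The policy regret is $$R_T=\sum_{t=1}^T f_t(X_1,\dots,X_t)-\min_{x\in V}\sum_{t=1}^T f_t(x,\dots,x),$$ and the minimax policy regret is $$\mathcal R_T(G)=\inf_{\text{player strategies}}\ \ \sup_{\text{adversaries with memory bounded by }1}\ \mathbb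 E[R_T].$$ Then for every strongly observable $G$ with at least two vertices, $\mathcal R_T(G)=\widetilde\Omega(T^{2/3})$, and in fact $\mathcal R_T(G)=\widetilde\Theta(T^{2/3})$. Precisely: 1. There are $c>0$ and $p,T_0\in\mathbb N$, not depending on $G$, such that for every strongly observable $G$ with at least two vertices and all $T\ge T_0$, $$\mathcal R_T(G)\ \ge\ \frac{c\,T^{2/3}}{(\log T)^{p}}.$$ 2. For every strongly observable $G$ with at least two vertices there are $C>0$ and $p,T_0\in\mathbb N$ such that for all $T\ge T_0$, $$\mathcal R_T(G)\ \le\ C\,T^{2/3}(\log T)^{p}.$$ -/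

import Mathlib

universe u

namespace GraphGame

/-- The in-neighbourhood `{w : (w, v) ∈ E}` of a vertex of a directed graph (loops allowed). -/
def inNbhd {V : Type u} (G : Digraph V) (v : V) : Set V := {w | G.Adj w v}

/-- The out-neighbourhood `{w : (v, w) ∈ E}` of a vertex of a directed graph (loops allowed). -/
def outNbhd {V : Type u} (G : Digraph V) (v : V) : Set V := {w | G.Adj v w}

/-- A vertex is strongly observable if it has a loop, or receives an edge from every other
vertex, or both. -/
def IsStronglyObservableVertex {V : Type u} (G : Digraph V) (v : V) : Prop :=
  {v} ⊆ inNbhd G v ∨ Set.univ \ {v} ⊆ inNbhd G v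

/-- A feedback graph is strongly observable if all its vertices are. -/
def IsStronglyObservable {V : Type u} (G : Digraph V) : Prop :=
  ∀ v : V, IsStronglyObservableVertex G v

/-- A sequence of loss functions of a (possibly adaptive) adversary. Rounds are numbered from `0`;
`f.loss t p a` is the loss in round `t` when `p` lists the actions played in the rounds
`0, …, t - 1` and `a` is the action played in round `t`. -/
structure LossSequence (V : Type u) where
  loss : (t : ℕ) → (Fin t → V) → V → ℝ
  loss_mem : ∀ (t : ℕ) (p : Fin t → V) (a : V), loss t p a ∈ Set.Icc (0 : ℝ) 1

/-- The adversary has memory bounded by `m`: the loss in round `t` depends only on the actions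
played in the rounds `t - m, …, t`. -/
def LossSequence.HasMemory {V : Type u} (f : LossSequence V) (m : ℕ) : Prop :=
  ∀ (t : ℕ) (p q : Fin t → V) (a : V),
    (∀ s : Fin t, t ≤ (s : ℕ) + m → p s = q s) → f.loss t p a = f.loss t q a

/-- A randomized player strategy. `prob t x y a` is the conditional probability of playing `a` in
round `t`, given the actions `x s` played and the feedback vectors `y s` received in the rounds
`s < t`. (As `V` is finite, measurability in `y` for each fixed `x` is joint measurability.) -/
structure Strategy (V : Type u) [Fintype V] where
  prob : (t : ℕ) → (Fin t → V) → (Fin t → V → ℝ) → V → ℝ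
  prob_nonneg : ∀ t x y a, 0 ≤ prob t x y a
  prob_sum : ∀ t x y, ∑ a : V, prob t x y a = 1
  prob_measurable : ∀ t x a, Measurable (fun y : Fin t → V → ℝ => prob t x y a)

/-- The actions played strictly before round `t`. -/
def past {V : Type u} {T : ℕ} (x : Fin T → V) (t : Fin T) : Fin t → V :=
  fun s => x ⟨s, s.2.trans t.2⟩

open Classical in
/-- The feedback of round `t` when the actions `x` are played: the player is shown the losses
`f_t(x_0, …, x_{t-1}, i)` of the out-neighbours `i` of the action `x_t` and nothing else. The
entries that are not shown are filled with `0`; the player knows the graph and the own action,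
hence which entries these are. -/
noncomputable def feedback {V : Type u} (G : Digraph V) (f : LossSequence V) {T : ℕ}
    (x : Fin T → V) (t : Fin T) : V → ℝ :=
  fun i => if i ∈ outNbhd G (x t) then f.loss t (past x t) i else 0

/-- The probability that exactly the actions `x` are played in the rounds `0, …, T - 1`. -/
noncomputable def playProb {V : Type u} [Fintype V] (G : Digraph V) (π : Strategy V)
    (f : LossSequence V) {T : ℕ} (x : Fin T → V) : ℝ :=
  ∏ t : Fin T, π.prob t (past x t) (fun s => feedback G f x ⟨s, s.2.trans t.2⟩) (x t)

/-- The policy regret of the actions `x`: their cumulative loss, minus the smallest cumulative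
loss that playing one and the same action in all rounds would have incurred. -/
noncomputable def policyRegret {V : Type u} (f : LossSequence V) {T : ℕ} (x : Fin T → V) : ℝ :=
  ∑ t : Fin T, f.loss t (past x t) (x t) - ⨅ a : V, ∑ t : Fin T, f.loss t (fun _ => a) a

/-- The expected policy regret over `T` rounds. -/
noncomputable def expectedRegret {V : Type u} [Fintype V] (G : Digraph V) (π : Strategy V)
    (f : LossSequence V) (T : ℕ) : ℝ :=
  ∑ x : Fin T → V, playProb G π f x * policyRegret f x

/-- The minimax policy regret over `T` rounds against adversaries with memory bounded by `m`. -/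
noncomputable def minimaxRegret {V : Type u} [Fintype V] (G : Digraph V) (m T : ℕ) : ℝ :=
  ⨅ π : Strategy V, ⨆ f : {f : LossSequence V // f.HasMemory m}, expectedRegret G π f.1 T

end GraphGame

namespace GraphGame

/-! ### Sums over finite histories -/

/-! Lower bound. Fix an action `v` and let the adversary charge, up to scaling, a hidden random walk
plus an offset determined by the previous action, plus 1/2 for each switch between `v` and the other
actions. The current action enters only through the switch penalty, so all losses shown in a round
reveal the same number, walk plus offset, and richer feedback does not help. In one world `v` has
the larger offset, in the other the smaller one. Shifting the walk by one unit exactly in the rounds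
that follow a play of `v` turns the feedback of one world into that of the other (`playProb_shift`).

The walk runs along the tree in which `n` descends from `n` with its lowest binary digit deleted.
Its depth is logarithmic, so the walk stays bounded, and each time is crossed by at most `D`, about
`log T`, edges (`card_crossing_le`). An increment carries information only if the label "`v` was
played" differs at the two ends of its edge, hence at most `D` increments per switch do
(`sum_visible_le`). The increments follow a squared tent of width `M`; a unit translation lowers the
Hellinger affinity by at most `5 / M ^ 2` and never wraps around on the support. So either the
player switches about `M ^ 2 / D` times and pays for it, or the two worlds overlap substantially,
and in one of them the wrong offset costs about `T / (M * D)` (`regret_lower_bound`). Taking `M`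
near `T ^ (1/3)` balances the two.

Upper bound. With at least two vertices, strong observability gives each action `v` an in-neighbour
`w v`. Time is cut into batches of length about `T ^ (1/3)`. In each batch a uniformly random action
is played at a uniformly random position and its observer right after it; this shows the loss of
playing that action twice in a row, which for memory 1 is its loss under constant play. All other
rounds follow a perturbed leader of the earlier estimates, so only a bounded number of rounds per
batch is wasted (`batch_loss_le`). The estimates lie in `[0,1]` and, multiplied by `|V| * b`, are
unbiased for the batch losses up to rounding. Follow-the-perturbed-leader with uniform noise on `L`
integers has regret at most `L + 2 * |V| * J / L` over `J` batches (`sum_perturbed_leader_le`);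
scaling up with `L = b` gives order `T ^ (2/3)`. -/

theorem sum_pi_fin_succ {A : Type*} [Fintype A] {T : ℕ} (F : (Fin (T + 1) → A) → ℝ) :
    ∑ x, F x = ∑ x : Fin T → A, ∑ a : A, F (Fin.snoc x a) := by
  rw [← (Fin.snocEquiv (fun _ : Fin (T + 1) => A)).sum_comp, Fintype.sum_prod_type_right]
  rfl

theorem past_last {A : Type*} {T : ℕ} (x : Fin (T + 1) → A) :
    past x (Fin.last T) = Fin.init x := rfl

theorem past_castSucc {A : Type*} {T : ℕ} (x : Fin (T + 1) → A) (t : Fin T) :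
    past x t.castSucc = past (Fin.init x) t := rfl

theorem init_snoc {A : Type*} {T : ℕ} (x : Fin T → A) (a : A) :
    Fin.init (Fin.snoc x a : Fin (T + 1) → A) = x :=
  Fin.init_snoc (α := fun _ => A) _ _

theorem snoc_last {A : Type*} {T : ℕ} (x : Fin T → A) (a : A) :
    (Fin.snoc x a : Fin (T + 1) → A) (Fin.last T) = a :=
  Fin.snoc_last (α := fun _ => A) _ _

/-! ### Probabilities of histories -/

section History

variable {V : Type u} [Fintype V]

/-- The probability that a strategy plays the actions `x` if the feedback is `y`. -/
noncomputable def Strategy.histProb (π : Strategy V) {t : ℕ} (x : Fin t → V)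
    (y : Fin t → V → ℝ) : ℝ :=
  ∏ s : Fin t, π.prob s (past x s) (past y s) (x s)

theorem Strategy.histProb_succ (π : Strategy V) {t : ℕ} (x : Fin (t + 1) → V)
    (y : Fin (t + 1) → V → ℝ) :
    π.histProb x y = π.histProb (Fin.init x) (Fin.init y) *
      π.prob t (Fin.init x) (Fin.init y) (x (Fin.last t)) := by
  unfold Strategy.histProb
  rw [Fin.prod_univ_castSucc]
  rfl

theorem Strategy.histProb_nonneg (π : Strategy V) {t : ℕ} (x : Fin t → V)
    (y : Fin t → V → ℝ) : 0 ≤ π.histProb x y :=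
  Finset.prod_nonneg fun _ _ => π.prob_nonneg _ _ _ _

theorem Strategy.histProb_measurable (π : Strategy V) {t : ℕ} (x : Fin t → V) :
    Measurable fun y : Fin t → V → ℝ => π.histProb x y := by
  unfold Strategy.histProb
  refine Finset.measurable_fun_prod _ fun s _ => ?_
  refine (π.prob_measurable s (past x s) (x s)).comp ?_
  exact measurable_pi_lambda _ fun r => measurable_pi_apply _

theorem playProb_eq_histProb (G : Digraph V) (π : Strategy V) (f : LossSequence V) {T : ℕ}
    (x : Fin T → V) : playProb G π f x = π.histProb x (feedback G f x) := rfl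

theorem playProb_nonneg (G : Digraph V) (π : Strategy V) (f : LossSequence V) {T : ℕ}
    (x : Fin T → V) : 0 ≤ playProb G π f x := by
  rw [playProb_eq_histProb]
  exact π.histProb_nonneg _ _

theorem playProb_succ (G : Digraph V) (π : Strategy V) (f : LossSequence V) {T : ℕ}
    (x : Fin (T + 1) → V) :
    playProb G π f x = playProb G π f (Fin.init x) *
      π.prob T (Fin.init x) (feedback G f (Fin.init x)) (x (Fin.last T)) := by
  rw [playProb_eq_histProb, π.histProb_succ]
  rfl

theorem sum_playProb (G : Digraph V) (π : Strategy V) (f : LossSequence V) (T : ℕ) :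
    ∑ x : Fin T → V, playProb G π f x = 1 := by
  induction T with
  | zero => simp [playProb]
  | succ T ih =>
    rw [sum_pi_fin_succ, ← ih]
    refine Finset.sum_congr rfl fun x _ => ?_
    simp only [playProb_succ, init_snoc, snoc_last]
    rw [← Finset.mul_sum, π.prob_sum, mul_one]

/-! ### Crude bounds on the regret -/

theorem iInf_le_of_fintype (h : V → ℝ) (a : V) : ⨅ b, h b ≤ h a :=
  ciInf_le (Set.finite_range h).bddBelow a

theorem abs_policyRegret_le [Nonempty V] (f : LossSequence V) {T : ℕ} (x : Fin T → V) :
    |policyRegret f x| ≤ T := by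
  have sum_mem : ∀ (p : (t : Fin T) → Fin t → V) (a : Fin T → V),
      0 ≤ ∑ t : Fin T, f.loss t (p t) (a t) ∧ ∑ t : Fin T, f.loss t (p t) (a t) ≤ T := by
    intro p a
    refine ⟨Finset.sum_nonneg fun t _ => (f.loss_mem _ _ _).1, ?_⟩
    calc _ ≤ ∑ _t : Fin T, (1 : ℝ) := Finset.sum_le_sum fun t _ => (f.loss_mem _ _ _).2
      _ = T := by simp
  have h1 := sum_mem (past x) x
  have h2 : 0 ≤ ⨅ a : V, ∑ t : Fin T, f.loss t (fun _ => a) a :=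
    le_ciInf fun a => (sum_mem (fun _ _ => a) fun _ => a).1
  have h3 : ⨅ a : V, ∑ t : Fin T, f.loss t (fun _ => a) a ≤ T := by
    obtain ⟨a⟩ := ‹Nonempty V›
    exact (iInf_le_of_fintype (fun a : V => ∑ t : Fin T, f.loss t (fun _ => a) a) a).trans
      (sum_mem (fun _ _ => a) fun _ => a).2
  unfold policyRegret
  rw [abs_le]
  constructor <;> linarith [h1.1, h1.2]

/-- Real infima and suprema are meaningful only for bounded families; this supplies the bounds
behind `minimaxRegret`. -/
theorem abs_expectedRegret_le [Nonempty V] (G : Digraph V) (π : Strategy V)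
    (f : LossSequence V) (T : ℕ) : |expectedRegret G π f T| ≤ T := by
  unfold expectedRegret
  calc _ ≤ ∑ x : Fin T → V, playProb G π f x * T := by
        refine (Finset.abs_sum_le_sum_abs _ _).trans (Finset.sum_le_sum fun x _ => ?_)
        rw [abs_mul, abs_of_nonneg (playProb_nonneg G π f x)]
        exact mul_le_mul_of_nonneg_left (abs_policyRegret_le f x) (playProb_nonneg G π f x)
    _ = T := by rw [← Finset.sum_mul, sum_playProb, one_mul]

theorem expectedRegret_le_iSup [Nonempty V] (G : Digraph V) (π : Strategy V) {m : ℕ}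
    (f : LossSequence V) (hf : f.HasMemory m) (T : ℕ) :
    expectedRegret G π f T ≤
      ⨆ f : {f : LossSequence V // f.HasMemory m}, expectedRegret G π f.1 T := by
  refine le_ciSup (f := fun f : {f : LossSequence V // f.HasMemory m} =>
    expectedRegret G π f.1 T) ⟨T, ?_⟩ ⟨f, hf⟩
  rintro _ ⟨f, rfl⟩
  exact (abs_le.1 (abs_expectedRegret_le G π f.1 T)).2

/-- The loss sequence that vanishes identically. -/
def LossSequence.zero (V : Type u) : LossSequence V where
  loss _ _ _ := 0
  loss_mem _ _ _ := by simp

theorem minimaxRegret_le [Nonempty V] (G : Digraph V) (π : Strategy V) {m T : ℕ} {R : ℝ}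
    (h : ∀ f : LossSequence V, f.HasMemory m → expectedRegret G π f T ≤ R) :
    minimaxRegret G m T ≤ R := by
  have hne : Nonempty {f : LossSequence V // f.HasMemory m} :=
    ⟨⟨LossSequence.zero V, fun _ _ _ _ _ => rfl⟩⟩
  refine (ciInf_le ⟨-(T : ℝ), ?_⟩ π).trans (ciSup_le fun f => h f.1 f.2)
  rintro _ ⟨π', rfl⟩
  obtain ⟨f⟩ := hne
  exact (abs_le.1 (abs_expectedRegret_le G π' f.1 T)).1.trans
    (expectedRegret_le_iSup G π' f.1 f.2 T)

/-! ### Mixtures of strategies -/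

/-- The total weight of the history `(x, y)` under a finite family of strategies. -/
noncomputable def totalHistProb {Ω : Type*} [Fintype Ω] (π : Ω → Strategy V) {t : ℕ}
    (x : Fin t → V) (y : Fin t → V → ℝ) : ℝ :=
  ∑ ω, (π ω).histProb x y

theorem totalHistProb_measurable {Ω : Type*} [Fintype Ω] (π : Ω → Strategy V) {t : ℕ}
    (x : Fin t → V) : Measurable fun y : Fin t → V → ℝ => totalHistProb π x y :=
  Finset.measurable_fun_sum _ fun ω _ => (π ω).histProb_measurable x

open Classical in
/-- The behavioural form of the strategy that draws one strategy of a finite family uniformly at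
random before the first round, and follows it. -/
noncomputable def Strategy.mixture {Ω : Type*} [Fintype Ω] [Nonempty Ω] (π : Ω → Strategy V) :
    Strategy V where
  prob t x y a :=
    -- Histories of total weight zero follow an arbitrary member, so that the probabilities sum to 1
    -- there too. Elsewhere the members are weighted by their posterior.
    if totalHistProb π x y = 0 then (π (Classical.arbitrary Ω)).prob t x y a
    else (∑ ω, (π ω).histProb x y * (π ω).prob t x y a) / totalHistProb π x y
  prob_nonneg t x y a := by
    split_ifs
    · exact (π _).prob_nonneg _ _ _ _
    · exact div_nonneg
        (Finset.sum_nonneg fun ω _ => mul_nonneg ((π ω).histProb_nonneg _ _)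
          ((π ω).prob_nonneg _ _ _ _))
        (Finset.sum_nonneg fun ω _ => (π ω).histProb_nonneg _ _)
  prob_sum t x y := by
    split_ifs with h
    · exact (π _).prob_sum _ _ _
    · rw [← Finset.sum_div, Finset.sum_comm]
      simp_rw [← Finset.mul_sum, (π _).prob_sum, mul_one]
      exact div_self h
  prob_measurable t x a := by
    refine Measurable.ite ?_ ((π _).prob_measurable _ _ _) ?_
    · exact totalHistProb_measurable π x (measurableSet_singleton 0)
    · refine Measurable.div ?_ (totalHistProb_measurable π x)
      exact Finset.measurable_fun_sum _ fun ω _ =>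
        ((π ω).histProb_measurable x).mul ((π ω).prob_measurable t x a)

/-- The posterior weights telescope: the denominator of each round cancels the total weight of the
history before it. Once that total vanishes, all summands vanish from then on. -/
theorem Strategy.mixture_histProb {Ω : Type*} [Fintype Ω] [Nonempty Ω] (π : Ω → Strategy V)
    {t : ℕ} (x : Fin t → V) (y : Fin t → V → ℝ) :
    (Strategy.mixture π).histProb x y = totalHistProb π x y / Fintype.card Ω := by
  induction t with
  | zero =>
    simp [Strategy.histProb, totalHistProb]
  | succ t ih =>
    rw [Strategy.histProb_succ, ih]
    set x' := Fin.init x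
    set y' := Fin.init y
    have hsucc : totalHistProb π x y =
        ∑ ω, (π ω).histProb x' y' * (π ω).prob t x' y' (x (Fin.last t)) :=
      Finset.sum_congr rfl fun ω _ => (π ω).histProb_succ x y
    by_cases h : totalHistProb π x' y' = 0
    · have h0 : ∀ ω, (π ω).histProb x' y' = 0 := fun ω =>
        (Finset.sum_eq_zero_iff_of_nonneg fun ω _ => (π ω).histProb_nonneg x' y').1 h ω
          (Finset.mem_univ ω)
      simp [h, hsucc, h0]
    · simp only [Strategy.mixture, h, if_false, hsucc]
      field_simp

theorem expectedRegret_mixture {Ω : Type*} [Fintype Ω] [Nonempty Ω] (G : Digraph V)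
    (π : Ω → Strategy V) (f : LossSequence V) (T : ℕ) :
    expectedRegret G (Strategy.mixture π) f T =
      (∑ ω, expectedRegret G (π ω) f T) / Fintype.card Ω := by
  unfold expectedRegret
  rw [Finset.sum_comm, Finset.sum_div]
  refine Finset.sum_congr rfl fun x _ => ?_
  rw [playProb_eq_histProb, Strategy.mixture_histProb, totalHistProb, ← Finset.sum_mul]
  simp_rw [playProb_eq_histProb]
  ring

/-- The strategy that plays a deterministic function of quantized feedback. -/
noncomputable def Strategy.quantized [DecidableEq V] (m : ℝ)
    (A : (t : ℕ) → (Fin t → V → ℤ) → V) : Strategy V where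
  prob t _ y a := if A t (fun s v => ⌊m * y s v⌋) = a then 1 else 0
  prob_nonneg t x y a := by split_ifs <;> simp
  prob_sum t x y := by simp
  prob_measurable t x a := by
    have h1 : Measurable fun y : Fin t → V → ℝ => fun s v => ⌊m * y s v⌋ := by
      refine measurable_pi_lambda _ fun s => measurable_pi_lambda _ fun v => ?_
      have h2 : Measurable fun y : Fin t → V → ℝ => y s v :=
        (measurable_pi_apply v).comp (measurable_pi_apply s)
      exact Int.measurable_floor.comp (h2.const_mul m)
    exact (measurable_of_countable
      (fun z : Fin t → V → ℤ => if A t z = a then (1 : ℝ) else 0)).comp h1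

theorem Strategy.quantized_consistent [DecidableEq V] (G : Digraph V) (m : ℝ)
    (A : (t : ℕ) → (Fin t → V → ℤ) → V) (f : LossSequence V) {T : ℕ} (x : Fin T → V)
    (h : playProb G (Strategy.quantized m A) f x ≠ 0) (t : Fin T) :
    x t = A t (fun s v => ⌊m * past (feedback G f x) t s v⌋) := by
  have h1 := Finset.prod_ne_zero_iff.1 h t (Finset.mem_univ t)
  by_contra hne
  exact h1 (if_neg fun h' => hne h'.symm)

/-- Plays inconsistent with the deterministic rule have weight zero, so a pointwise bound on the
consistent ones suffices. Rounding to integers makes any such rule measurable. -/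
theorem expectedRegret_quantized_le [DecidableEq V] (G : Digraph V) (m : ℝ)
    (A : (t : ℕ) → (Fin t → V → ℤ) → V) (f : LossSequence V) {T : ℕ} {R : ℝ}
    (h : ∀ x : Fin T → V,
      (∀ t, x t = A t (fun s v => ⌊m * past (feedback G f x) t s v⌋)) → policyRegret f x ≤ R) :
    expectedRegret G (Strategy.quantized m A) f T ≤ R := by
  unfold expectedRegret
  calc _ ≤ ∑ x : Fin T → V, playProb G (Strategy.quantized m A) f x * R := by
        refine Finset.sum_le_sum fun x _ => ?_
        by_cases hx : playProb G (Strategy.quantized m A) f x = 0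
        · simp [hx]
        · exact mul_le_mul_of_nonneg_left (h x (Strategy.quantized_consistent G m A f x hx))
            (playProb_nonneg _ _ _ _)
    _ = R := by rw [← Finset.sum_mul, sum_playProb, one_mul]

end History

/-! ### The Hellinger affinity of two interactive experiments -/

section Affinity

variable {V Z : Type*}

/-- The weight of the actions `x` and the noise `ξ` when in every round an action is drawn from
`q` given the past, and then noise is drawn from `p` given the actions. -/
noncomputable def jointWeight (q : (t : ℕ) → (Fin t → V) → (Fin t → Z) → V → ℝ)
    (p : (t : ℕ) → (Fin t → V) → V → Z → ℝ) {T : ℕ} (x : Fin T → V) (ξ : Fin T → Z) : ℝ :=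
  ∏ t : Fin T, q t (past x t) (past ξ t) (x t) * p t (past x t) (x t) (ξ t)

variable {q : (t : ℕ) → (Fin t → V) → (Fin t → Z) → V → ℝ}
  {p p₁ p₂ : (t : ℕ) → (Fin t → V) → V → Z → ℝ}

theorem jointWeight_snoc {T : ℕ} (x : Fin T → V) (ξ : Fin T → Z) (a : V) (z : Z) :
    jointWeight q p (Fin.snoc x a : Fin (T + 1) → V) (Fin.snoc ξ z : Fin (T + 1) → Z) =
      jointWeight q p x ξ * (q T x ξ a * p T x a z) := by
  unfold jointWeight
  rw [Fin.prod_univ_castSucc]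
  simp only [past_castSucc, past_last, init_snoc, snoc_last, Fin.snoc_castSucc]
  rfl

theorem jointWeight_nonneg (hq : ∀ t x ξ a, 0 ≤ q t x ξ a) (hp : ∀ t x a z, 0 ≤ p t x a z)
    {T : ℕ} (x : Fin T → V) (ξ : Fin T → Z) : 0 ≤ jointWeight q p x ξ :=
  Finset.prod_nonneg fun _ _ => mul_nonneg (hq _ _ _ _) (hp _ _ _ _)

variable [Fintype V] [Fintype Z]

theorem sum_sum_pi_fin_succ {T : ℕ} (F : (Fin (T + 1) → V) → (Fin (T + 1) → Z) → ℝ) :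
    ∑ x, ∑ ξ, F x ξ =
      ∑ x : Fin T → V, ∑ ξ : Fin T → Z, ∑ a : V, ∑ z : Z, F (Fin.snoc x a) (Fin.snoc ξ z) := by
  rw [sum_pi_fin_succ]
  refine Finset.sum_congr rfl fun x _ => ?_
  symm
  rw [Finset.sum_comm]
  exact Finset.sum_congr rfl fun a _ =>
    (sum_pi_fin_succ fun ξ : Fin (T + 1) → Z => F (Fin.snoc x a) ξ).symm

theorem sum_jointWeight_mul_succ (hp1 : ∀ t x a, ∑ z, p t x a z = 1) {T : ℕ}
    (H : (Fin (T + 1) → V) → ℝ) :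
    ∑ x, ∑ ξ, jointWeight q p x ξ * H x =
      ∑ x : Fin T → V, ∑ ξ : Fin T → Z,
        jointWeight q p x ξ * ∑ a, q T x ξ a * H (Fin.snoc x a) := by
  rw [sum_sum_pi_fin_succ]
  refine Finset.sum_congr rfl fun x _ => Finset.sum_congr rfl fun ξ _ => ?_
  rw [Finset.mul_sum]
  refine Finset.sum_congr rfl fun a _ => ?_
  simp only [jointWeight_snoc]
  rw [← Finset.sum_mul, ← Finset.mul_sum, ← Finset.mul_sum, hp1]
  ring

theorem sum_jointWeight (hq1 : ∀ t x ξ, ∑ a, q t x ξ a = 1)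
    (hp1 : ∀ t x a, ∑ z, p t x a z = 1) (T : ℕ) :
    ∑ x : Fin T → V, ∑ ξ : Fin T → Z, jointWeight q p x ξ = 1 := by
  induction T with
  | zero => simp [jointWeight]
  | succ T ih =>
    have h := sum_jointWeight_mul_succ (q := q) hp1 (T := T) fun _ => 1
    simp only [mul_one, hq1] at h
    rw [h, ih]

/-- Two interactive experiments whose noise kernels are close whenever `vis` is small have large
Hellinger affinity. -/
theorem one_le_affinity_add (hq : ∀ t x ξ a, 0 ≤ q t x ξ a)
    (hq1 : ∀ t x ξ, ∑ a, q t x ξ a = 1)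
    (hp₁ : ∀ t x a z, 0 ≤ p₁ t x a z) (hp₁1 : ∀ t x a, ∑ z, p₁ t x a z = 1)
    (hp₂ : ∀ t x a z, 0 ≤ p₂ t x a z) (hp₂1 : ∀ t x a, ∑ z, p₂ t x a z = 1)
    (vis : (t : ℕ) → (Fin t → V) → V → ℝ) (hvis : ∀ t x a, 0 ≤ vis t x a)
    {κ : ℝ} (hκ : 0 ≤ κ)
    (haff : ∀ t x a, 1 - κ * vis t x a ≤ ∑ z, √(p₁ t x a z) * √(p₂ t x a z)) (T : ℕ) :
    1 ≤ ∑ x : Fin T → V, ∑ ξ : Fin T → Z, √(jointWeight q p₁ x ξ) * √(jointWeight q p₂ x ξ) +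
      κ / 2 * (∑ x : Fin T → V, ∑ ξ : Fin T → Z,
          jointWeight q p₁ x ξ * ∑ t : Fin T, vis t (past x t) (x t) +
        ∑ x : Fin T → V, ∑ ξ : Fin T → Z,
          jointWeight q p₂ x ξ * ∑ t : Fin T, vis t (past x t) (x t)) := by
  induction T with
  | zero => simp [jointWeight]
  | succ T ih =>
    refine ih.trans ?_
    have hexp : ∀ p : (t : ℕ) → (Fin t → V) → V → Z → ℝ, (∀ t x a, ∑ z, p t x a z = 1) →
        ∑ x : Fin (T + 1) → V, ∑ ξ : Fin (T + 1) → Z,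
          jointWeight q p x ξ * ∑ t : Fin (T + 1), vis t (past x t) (x t) =
        ∑ x : Fin T → V, ∑ ξ : Fin T → Z,
          jointWeight q p x ξ * ∑ t : Fin T, vis t (past x t) (x t) +
        ∑ x : Fin T → V, ∑ ξ : Fin T → Z,
          jointWeight q p x ξ * ∑ a, q T x ξ a * vis T x a := by
      intro p hp
      rw [sum_jointWeight_mul_succ hp, ← Finset.sum_add_distrib]
      refine Finset.sum_congr rfl fun x _ => ?_
      rw [← Finset.sum_add_distrib]
      refine Finset.sum_congr rfl fun ξ _ => ?_
      have h1 : ∀ a, ∑ t : Fin (T + 1), vis t (past (Fin.snoc x a : Fin (T + 1) → V) t)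
          ((Fin.snoc x a : Fin (T + 1) → V) t) =
          ∑ t : Fin T, vis t (past x t) (x t) + vis T x a := by
        intro a
        rw [Fin.sum_univ_castSucc]
        simp only [past_castSucc, past_last, init_snoc, snoc_last, Fin.snoc_castSucc]
        rfl
      simp only [h1, mul_add, Finset.sum_add_distrib]
      rw [← Finset.sum_mul, hq1, one_mul]
    rw [hexp p₁ hp₁1, hexp p₂ hp₂1]
    -- Given the past, one more round multiplies the affinity by at least 1 minus `κ` times the
    -- conditional mean of `vis`.
    have hstep : ∑ x : Fin T → V, ∑ ξ : Fin T → Z,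
          √(jointWeight q p₁ x ξ) * √(jointWeight q p₂ x ξ) -
        κ / 2 * (∑ x : Fin T → V, ∑ ξ : Fin T → Z,
            jointWeight q p₁ x ξ * ∑ a, q T x ξ a * vis T x a +
          ∑ x : Fin T → V, ∑ ξ : Fin T → Z,
            jointWeight q p₂ x ξ * ∑ a, q T x ξ a * vis T x a) ≤
        ∑ x : Fin (T + 1) → V, ∑ ξ : Fin (T + 1) → Z,
          √(jointWeight q p₁ x ξ) * √(jointWeight q p₂ x ξ) := by
      rw [sum_sum_pi_fin_succ, ← Finset.sum_add_distrib, Finset.mul_sum,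
        ← Finset.sum_sub_distrib]
      refine Finset.sum_le_sum fun x _ => ?_
      rw [← Finset.sum_add_distrib, Finset.mul_sum, ← Finset.sum_sub_distrib]
      refine Finset.sum_le_sum fun ξ _ => ?_
      have w₁ := jointWeight_nonneg hq hp₁ x ξ
      have w₂ := jointWeight_nonneg hq hp₂ x ξ
      -- AM-GM bounds the affinity lost by the mean of `vis` averaged over the two experiments,
      -- which is what the regret bounds control.
      have hmean : √(jointWeight q p₁ x ξ) * √(jointWeight q p₂ x ξ) ≤
          (jointWeight q p₁ x ξ + jointWeight q p₂ x ξ) / 2 := by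
        nlinarith [sq_nonneg (√(jointWeight q p₁ x ξ) - √(jointWeight q p₂ x ξ)),
          Real.sq_sqrt w₁, Real.sq_sqrt w₂]
      have hv : 0 ≤ ∑ a, q T x ξ a * vis T x a :=
        Finset.sum_nonneg fun a _ => mul_nonneg (hq _ _ _ _) (hvis _ _ _)
      have hsplit : ∀ a z, √(jointWeight q p₁ (Fin.snoc x a : Fin (T + 1) → V)
            (Fin.snoc ξ z : Fin (T + 1) → Z)) *
          √(jointWeight q p₂ (Fin.snoc x a : Fin (T + 1) → V)
            (Fin.snoc ξ z : Fin (T + 1) → Z)) =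
          √(jointWeight q p₁ x ξ) * √(jointWeight q p₂ x ξ) *
            (q T x ξ a * (√(p₁ T x a z) * √(p₂ T x a z))) := by
        intro a z
        rw [jointWeight_snoc, jointWeight_snoc, Real.sqrt_mul w₁, Real.sqrt_mul w₂,
          Real.sqrt_mul (hq _ _ _ _), Real.sqrt_mul (hq _ _ _ _)]
        linear_combination √(jointWeight q p₁ x ξ) * √(jointWeight q p₂ x ξ) *
          √(p₁ T x a z) * √(p₂ T x a z) * Real.mul_self_sqrt (hq T x ξ a)
      simp only [hsplit, ← Finset.mul_sum]
      have hlow : 1 - κ * ∑ a, q T x ξ a * vis T x a ≤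
          ∑ a, q T x ξ a * ∑ z, √(p₁ T x a z) * √(p₂ T x a z) := by
        rw [← hq1 T x ξ, Finset.mul_sum, ← Finset.sum_sub_distrib]
        refine Finset.sum_le_sum fun a _ => ?_
        have := mul_le_mul_of_nonneg_left (haff T x a) (hq T x ξ a)
        linarith
      have h1 := mul_le_mul_of_nonneg_left hlow
        (mul_nonneg (Real.sqrt_nonneg (jointWeight q p₁ x ξ))
          (Real.sqrt_nonneg (jointWeight q p₂ x ξ)))
      have h2 := mul_le_mul_of_nonneg_right hmean (mul_nonneg hκ hv)
      linarith
    linarith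

/-- Two distributions with large Hellinger affinity have a large overlap. -/
theorem sq_affinity_le_two_mul_overlap {ι : Type*} [Fintype ι] (w₁ w₂ : ι → ℝ)
    (h₁ : ∀ i, 0 ≤ w₁ i) (h₂ : ∀ i, 0 ≤ w₂ i) (s₁ : ∑ i, w₁ i = 1) (s₂ : ∑ i, w₂ i = 1) :
    (∑ i, √(w₁ i) * √(w₂ i)) ^ 2 ≤ 2 * ∑ i, min (w₁ i) (w₂ i) := by
  -- With this form, Cauchy-Schwarz separates the overlap from a factor of mass at most 2.
  have heq : ∀ i, √(w₁ i) * √(w₂ i) = √(min (w₁ i) (w₂ i)) * √(max (w₁ i) (w₂ i)) := by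
    intro i
    rw [← Real.sqrt_mul (h₁ i), ← Real.sqrt_mul (le_min (h₁ i) (h₂ i)), min_mul_max]
  have hmax : ∑ i, max (w₁ i) (w₂ i) ≤ 2 := by
    calc _ ≤ ∑ i, (w₁ i + w₂ i) := Finset.sum_le_sum fun i _ =>
          max_le (le_add_of_nonneg_right (h₂ i)) (le_add_of_nonneg_left (h₁ i))
      _ = 2 := by rw [Finset.sum_add_distrib, s₁, s₂]; norm_num
  have hmin : 0 ≤ ∑ i, min (w₁ i) (w₂ i) :=
    Finset.sum_nonneg fun i _ => le_min (h₁ i) (h₂ i)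
  calc _ = (∑ i, √(min (w₁ i) (w₂ i)) * √(max (w₁ i) (w₂ i))) ^ 2 := by simp_rw [heq]
    _ ≤ (∑ i, √(min (w₁ i) (w₂ i)) ^ 2) * ∑ i, √(max (w₁ i) (w₂ i)) ^ 2 :=
        Finset.sum_mul_sq_le_sq_mul_sq _ _ _
    _ = (∑ i, min (w₁ i) (w₂ i)) * ∑ i, max (w₁ i) (w₂ i) := by
        congr 1 <;> refine Finset.sum_congr rfl fun i _ => Real.sq_sqrt ?_
        · exact le_min (h₁ i) (h₂ i)
        · exact (h₁ i).trans (le_max_left _ _)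
    _ ≤ _ := by nlinarith

end Affinity

/-! ### A smooth distribution of bounded support on a cycle -/

section Tent

/-- The tent function on `ℤ / (2 M + 1)`. -/
def tent (M : ℕ) (z : ZMod (2 * M + 1)) : ℕ := min z.val (2 * M - z.val)

theorem val_lt (M : ℕ) (z : ZMod (2 * M + 1)) : z.val < 2 * M + 1 := ZMod.val_lt z

theorem val_add_one_eq {M : ℕ} (hM : 1 ≤ M) (z : ZMod (2 * M + 1)) :
    (z + 1).val = if z.val = 2 * M then 0 else z.val + 1 := by
  have := val_lt M z
  have h1 : (1 : ZMod (2 * M + 1)).val = 1 := by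
    have : Fact (1 < 2 * M + 1) := ⟨by omega⟩
    exact ZMod.val_one _
  rw [ZMod.val_add, h1]
  split_ifs with h
  · rw [h, Nat.mod_self]
  · exact Nat.mod_eq_of_lt (by omega)

theorem abs_tent_succ_sub_le {M : ℕ} (hM : 1 ≤ M) (z : ZMod (2 * M + 1)) :
    |(tent M (z + 1) : ℝ) - tent M z| ≤ 1 := by
  have h0 := val_lt M z
  have : tent M (z + 1) ≤ tent M z + 1 ∧ tent M z ≤ tent M (z + 1) + 1 := by
    unfold tent
    rw [val_add_one_eq hM]
    split_ifs <;> omega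
  have h1 : (tent M (z + 1) : ℝ) ≤ tent M z + 1 := by exact_mod_cast this.1
  have h2 : (tent M z : ℝ) ≤ tent M (z + 1) + 1 := by exact_mod_cast this.2
  rw [abs_le]
  constructor <;> linarith

/-- The total mass of the squared tent function. -/
def tentMass (M : ℕ) : ℝ := ∑ z : ZMod (2 * M + 1), (tent M z : ℝ) ^ 2

theorem cube_le_three_mul_tentMass (M : ℕ) : (M : ℝ) ^ 3 ≤ 3 * tentMass M := by
  have h1 : tentMass M = ∑ i ∈ Finset.range (2 * M + 1), ((min i (2 * M - i) : ℕ) : ℝ) ^ 2 :=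
    Fin.sum_univ_eq_sum_range (fun i => ((min i (2 * M - i) : ℕ) : ℝ) ^ 2) (2 * M + 1)
  have h2 : ∑ i ∈ Finset.range (M + 1), (i : ℝ) ^ 2 ≤ tentMass M := by
    rw [h1]
    calc _ = ∑ i ∈ Finset.range (M + 1), ((min i (2 * M - i) : ℕ) : ℝ) ^ 2 := by
          refine Finset.sum_congr rfl fun i hi => ?_
          rw [min_eq_left (by have := Finset.mem_range.1 hi; omega)]
      _ ≤ _ := Finset.sum_le_sum_of_subset_of_nonneg
          (Finset.range_subset_range.2 (by omega)) fun _ _ _ => sq_nonneg _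
  have h3 : ∀ n : ℕ, (n : ℝ) ^ 3 ≤ 3 * ∑ i ∈ Finset.range (n + 1), (i : ℝ) ^ 2 := by
    intro n
    induction n with
    | zero => simp
    | succ n ih =>
      rw [Finset.sum_range_succ]
      push_cast
      nlinarith [(Nat.cast_nonneg n : (0 : ℝ) ≤ n)]
  linarith [h3 M]

theorem tentMass_pos {M : ℕ} (hM : 1 ≤ M) : 0 < tentMass M := by
  have h := cube_le_three_mul_tentMass M
  have : (1 : ℝ) ≤ M := by exact_mod_cast hM
  have : 0 < (M : ℝ) ^ 3 := by positivity
  linarith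

/-- The probability distribution proportional to the squared tent function. -/
noncomputable def tentProb (M : ℕ) (z : ZMod (2 * M + 1)) : ℝ := (tent M z : ℝ) ^ 2 / tentMass M

theorem tentProb_nonneg (M : ℕ) (z : ZMod (2 * M + 1)) : 0 ≤ tentProb M z :=
  div_nonneg (sq_nonneg _) (Finset.sum_nonneg fun _ _ => sq_nonneg _)

theorem sum_tentProb {M : ℕ} (hM : 1 ≤ M) : ∑ z, tentProb M z = 1 := by
  unfold tentProb
  rw [← Finset.sum_div]
  exact div_self (tentMass_pos hM).ne'

theorem sum_tentProb_add {M : ℕ} (hM : 1 ≤ M) (c : ZMod (2 * M + 1)) :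
    ∑ z, tentProb M (z + c) = 1 := by
  rw [← sum_tentProb hM]
  exact Equiv.sum_comp (Equiv.addRight c) (tentProb M)

theorem val_pos_of_tentProb_ne_zero {M : ℕ} {z : ZMod (2 * M + 1)} (h : tentProb M z ≠ 0) :
    0 < z.val ∧ z.val < 2 * M := by
  have h1 : tent M z ≠ 0 := by
    intro h0
    simp [tentProb, h0] at h
  unfold tent at h1
  omega

theorem sqrt_tentProb (M : ℕ) (z : ZMod (2 * M + 1)) :
    √(tentProb M z) = tent M z / √(tentMass M) := by
  rw [tentProb, Real.sqrt_div (sq_nonneg _), Real.sqrt_sq (Nat.cast_nonneg _)]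

/-- The square root of the density is a tent of slope at most 1, so its squared difference with the
translate sums to at most `2 * M + 1`. One minus the affinity is half of this over the mass, which
is at least `M ^ 3 / 3`; that gives `9 / (2 * M ^ 2)`. -/
theorem one_sub_le_affinity_tentProb {M : ℕ} (hM : 1 ≤ M) :
    1 - 5 / (M : ℝ) ^ 2 ≤ ∑ z, √(tentProb M z) * √(tentProb M (z + 1)) := by
  have hpos := tentMass_pos hM
  have hM1 : (1 : ℝ) ≤ M := by exact_mod_cast hM
  have heq : ∑ z, √(tentProb M z) * √(tentProb M (z + 1)) =
      (∑ z, (tent M z : ℝ) * tent M (z + 1)) / tentMass M := by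
    rw [Finset.sum_div]
    refine Finset.sum_congr rfl fun z _ => ?_
    rw [sqrt_tentProb, sqrt_tentProb, div_mul_div_comm, Real.mul_self_sqrt hpos.le]
  have hshift : ∑ z, (tent M (z + 1) : ℝ) ^ 2 = tentMass M :=
    Equiv.sum_comp (Equiv.addRight (1 : ZMod (2 * M + 1))) fun z => (tent M z : ℝ) ^ 2
  have hdiff : ∑ z : ZMod (2 * M + 1), ((tent M (z + 1) : ℝ) - tent M z) ^ 2 ≤ 2 * M + 1 := by
    calc _ ≤ ∑ _z : ZMod (2 * M + 1), (1 : ℝ) :=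
          Finset.sum_le_sum fun z _ => (sq_le_one_iff_abs_le_one _).2 (abs_tent_succ_sub_le hM z)
      _ = 2 * M + 1 := by simp [ZMod.card]
  have hexp : ∑ z : ZMod (2 * M + 1), ((tent M (z + 1) : ℝ) - tent M z) ^ 2 =
      2 * tentMass M - 2 * ∑ z, (tent M z : ℝ) * tent M (z + 1) := by
    calc _ = ∑ z : ZMod (2 * M + 1), ((tent M (z + 1) : ℝ) ^ 2 + (tent M z : ℝ) ^ 2 -
          2 * ((tent M z : ℝ) * tent M (z + 1))) :=
          Finset.sum_congr rfl fun z _ => by ring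
      _ = _ := by
          rw [Finset.sum_sub_distrib, Finset.sum_add_distrib, hshift, ← Finset.mul_sum]
          unfold tentMass
          ring
  rw [heq, le_div_iff₀ hpos]
  have h1 : (M : ℝ) ≤ 3 * (tentMass M / (M : ℝ) ^ 2) := by
    rw [← mul_div_assoc, le_div_iff₀ (by positivity)]
    linarith [cube_le_three_mul_tentMass M, pow_succ' (M : ℝ) 2]
  have h2 : (1 - 5 / (M : ℝ) ^ 2) * tentMass M = tentMass M - 5 * (tentMass M / (M : ℝ) ^ 2) := by
    ring
  rw [h2]
  linarith

end Tent

/-! ### The multi-scale random walk -/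

section Walk

/-- The number that arises from `n` by deleting its lowest binary digit `1`. -/
def parent (n : ℕ) : ℕ := n - 2 ^ padicValNat 2 n

theorem parent_eq {n : ℕ} (hn : n ≠ 0) :
    ∃ k, n = 2 ^ padicValNat 2 n * (2 * k + 1) ∧ parent n = 2 ^ padicValNat 2 n * (2 * k) := by
  obtain ⟨m, hm⟩ := pow_padicValNat_dvd (p := 2) (n := n)
  have hodd : ¬ 2 ∣ m := fun ⟨j, hj⟩ =>
    pow_succ_padicValNat_not_dvd (p := 2) hn ⟨j, by rw [pow_succ, mul_assoc, ← hj, ← hm]⟩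
  obtain ⟨k, rfl⟩ : ∃ k, m = 2 * k + 1 := ⟨m / 2, by omega⟩
  refine ⟨k, hm, ?_⟩
  unfold parent
  conv_lhs => enter [1]; rw [hm]
  rw [mul_add, mul_one, Nat.add_sub_cancel]

theorem parent_lt {n : ℕ} (hn : n ≠ 0) : parent n < n :=
  Nat.sub_lt (Nat.pos_of_ne_zero hn) (by positivity)

theorem parent_succ_le (n : ℕ) : parent (n + 1) ≤ n :=
  Nat.lt_succ_iff.1 (parent_lt n.succ_ne_zero)

theorem padicValNat_two_lt {n D : ℕ} (hn : n ≠ 0) (h : n < 2 ^ D) : padicValNat 2 n < D :=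
  (Nat.pow_lt_pow_iff_right (by norm_num)).1
    ((Nat.le_of_dvd (Nat.pos_of_ne_zero hn) pow_padicValNat_dvd).trans_lt h)

/-- The sum of the increments `ζ` along the branch of the tree given by `parent`; the increment of
the node `n + 1` is `ζ n`. -/
def walk (ζ : ℕ → ℕ) : ℕ → ℕ
  | 0 => 0
  | n + 1 => walk ζ (parent (n + 1)) + ζ n
termination_by n => n
decreasing_by exact parent_lt n.succ_ne_zero

theorem walk_zero (ζ : ℕ → ℕ) : walk ζ 0 = 0 := by rw [walk]

theorem walk_succ (ζ : ℕ → ℕ) (n : ℕ) : walk ζ (n + 1) = walk ζ (parent (n + 1)) + ζ n := by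
  rw [walk]

/-- Each step to a nonzero parent raises the 2-adic valuation, which stays below `D`, so the branch
of `n` has at most `D - padicValNat 2 n` edges. -/
theorem walk_le_of_ne_zero {ζ : ℕ → ℕ} {N D : ℕ} (hζ : ∀ i, ζ i ≤ N) :
    ∀ n, n ≠ 0 → n < 2 ^ D → walk ζ n ≤ (D - padicValNat 2 n) * N := by
  intro n
  induction n using Nat.strong_induction_on with
  | _ n ih =>
    intro hn hD
    have hv := padicValNat_two_lt hn hD
    obtain ⟨k, hk, hp⟩ := parent_eq hn
    obtain ⟨j, rfl⟩ := Nat.exists_eq_succ_of_ne_zero hn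
    rw [Nat.succ_eq_add_one] at *
    rw [walk_succ]
    have hone : ζ j ≤ 1 * N := by simpa using hζ j
    by_cases h0 : parent (j + 1) = 0
    · rw [h0, walk_zero, zero_add]
      exact hone.trans (Nat.mul_le_mul_right _ (by omega))
    · have hlt := parent_lt hn
      have h1 := ih _ hlt h0 (hlt.trans hD)
      have h2 : padicValNat 2 (j + 1) + 1 ≤ padicValNat 2 (parent (j + 1)) := by
        rw [← padicValNat_dvd_iff_le h0, hp]
        exact ⟨k, by ring⟩
      calc _ ≤ (D - padicValNat 2 (parent (j + 1))) * N + 1 * N := add_le_add h1 hone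
        _ = (D - padicValNat 2 (parent (j + 1)) + 1) * N := by ring
        _ ≤ _ := Nat.mul_le_mul_right _ (by omega)

theorem walk_le {ζ : ℕ → ℕ} {N D : ℕ} (hζ : ∀ i, ζ i ≤ N) {n : ℕ} (hn : n < 2 ^ D) :
    walk ζ n ≤ D * N := by
  by_cases h0 : n = 0
  · simp [h0, walk_zero]
  · exact (walk_le_of_ne_zero hζ n h0 hn).trans (Nat.mul_le_mul_right _ (Nat.sub_le _ _))

theorem walk_congr {ζ ζ' : ℕ → ℕ} : ∀ n, (∀ i < n, ζ i = ζ' i) → walk ζ n = walk ζ' n := by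
  intro n
  induction n using Nat.strong_induction_on with
  | _ n ih =>
    intro h
    cases n with
    | zero => rw [walk_zero, walk_zero]
    | succ n =>
      have hlt := parent_lt n.succ_ne_zero
      rw [walk_succ, walk_succ, h n n.lt_succ_self,
        ih _ hlt fun i hi => h i (hi.trans hlt)]

/-- The differences of `c` along a branch telescope. -/
theorem walk_shift {ζ ζ' : ℕ → ℕ} {c : ℕ → ℤ} (hc : c 0 = 0) {T : ℕ}
    (h : ∀ t < T, (ζ' t : ℤ) = ζ t + (c (t + 1) - c (parent (t + 1)))) :
    ∀ n ≤ T, (walk ζ' n : ℤ) = walk ζ n + c n := by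
  intro n
  induction n using Nat.strong_induction_on with
  | _ n ih =>
    intro hn
    cases n with
    | zero => simp [walk_zero, hc]
    | succ n =>
      have hlt := parent_lt n.succ_ne_zero
      have h1 := ih _ hlt (hlt.le.trans hn)
      have h2 := h n hn
      rw [walk_succ, walk_succ]
      push_cast
      rw [h1, h2]
      ring

/-- In the tree given by `parent`, every time is crossed by few edges. -/
theorem card_crossing_le {T D : ℕ} (hT : T < 2 ^ D) (s : ℕ) :
    ((Finset.range T).filter fun t => parent (t + 1) ≤ s ∧ s ≤ t).card ≤ D := by
  rw [← Finset.card_range D]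
  refine Finset.card_le_card_of_injOn (fun t => padicValNat 2 (t + 1)) ?_ ?_
  · intro t ht
    have ht' := Finset.mem_range.1 (Finset.mem_filter.1 (Finset.mem_coe.1 ht)).1
    exact Finset.mem_coe.2 (Finset.mem_range.2
      (padicValNat_two_lt t.succ_ne_zero (lt_of_le_of_lt ht' hT)))
  · have key : ∀ t, parent (t + 1) ≤ s → s ≤ t →
        t + 1 = 2 ^ padicValNat 2 (t + 1) * (s / 2 ^ padicValNat 2 (t + 1) + 1) := by
      intro t h1 h2
      obtain ⟨k, hk, hp⟩ := parent_eq t.succ_ne_zero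
      rw [Nat.succ_eq_add_one] at *
      have hdiv : s / 2 ^ padicValNat 2 (t + 1) = 2 * k := by
        refine Nat.div_eq_of_lt_le ?_ ?_
        · rw [mul_comm, ← hp]; exact h1
        · rw [mul_comm, ← hk]; exact Nat.lt_succ_of_le h2
      rw [hdiv]; exact hk
    intro t ht t' ht' heq
    simp only [Finset.coe_filter, Set.mem_ofPred_eq] at ht ht'
    have e1 := key t ht.2.1 ht.2.2
    have e2 := key t' ht'.2.1 ht'.2.2
    simp only at heq
    rw [heq, ← e2] at e1
    omega

theorem exists_change {c : ℕ → ℤ} {p n : ℕ} (hpn : p ≤ n) (h : c n ≠ c p) :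
    ∃ s, p ≤ s ∧ s < n ∧ c (s + 1) ≠ c s := by
  induction n, hpn using Nat.le_induction with
  | base => exact absurd rfl h
  | succ n hn ih =>
    by_cases h1 : c (n + 1) = c n
    · obtain ⟨s, hs⟩ := ih (by rwa [← h1])
      exact ⟨s, hs.1, by omega, hs.2.2⟩
    · exact ⟨n, hn, n.lt_succ_self, h1⟩

/-- If the two ends of an edge have different labels, the label changes at some time that the edge
crosses; each such time is charged at most `D` times. -/
theorem sum_parent_change_le {T D : ℕ} (hT : T < 2 ^ D) (c : ℕ → ℤ) :
    ∑ t ∈ Finset.range T, (if c (t + 1) = c (parent (t + 1)) then (0 : ℝ) else 1) ≤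
      D * ∑ t ∈ Finset.range T, (if c (t + 1) = c t then (0 : ℝ) else 1) := by
  calc _ ≤ ∑ t ∈ Finset.range T, ∑ s ∈ Finset.range T,
        (if parent (t + 1) ≤ s ∧ s ≤ t then (1 : ℝ) else 0) *
          (if c (s + 1) = c s then (0 : ℝ) else 1) := by
        refine Finset.sum_le_sum fun t ht => ?_
        have hnn : ∀ s ∈ Finset.range T,
            0 ≤ (if parent (t + 1) ≤ s ∧ s ≤ t then (1 : ℝ) else 0) *
              (if c (s + 1) = c s then (0 : ℝ) else 1) := by
          intro s _
          split_ifs <;> simp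
        split_ifs with h
        · exact Finset.sum_nonneg hnn
        · obtain ⟨s, h1, h2, h3⟩ := exists_change (parent_lt t.succ_ne_zero).le h
          have hs : s ∈ Finset.range T := by
            have := Finset.mem_range.1 ht
            exact Finset.mem_range.2 (by omega)
          refine le_trans ?_ (Finset.single_le_sum hnn hs)
          rw [if_pos ⟨h1, by omega⟩, if_neg h3, one_mul]
    _ = ∑ s ∈ Finset.range T,
        (((Finset.range T).filter fun t => parent (t + 1) ≤ s ∧ s ≤ t).card : ℝ) *
          (if c (s + 1) = c s then (0 : ℝ) else 1) := by
        rw [Finset.sum_comm]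
        refine Finset.sum_congr rfl fun s _ => ?_
        rw [← Finset.sum_mul, Finset.sum_boole]
    _ ≤ _ := by
        rw [Finset.mul_sum]
        refine Finset.sum_le_sum fun s _ => mul_le_mul_of_nonneg_right ?_ (by split_ifs <;> simp)
        exact_mod_cast card_crossing_le hT s

end Walk

/-! ### The adversary of the lower bound -/

section Adversary

variable {V : Type u} [DecidableEq V]

/-- The loss of the multi-scale adversary: it charges the value of the random walk, shifted by an
offset `o` that depends on the previous action, and switching between `v` and the other
actions. -/
noncomputable def walkLoss (M D : ℕ) (v : V) (o : V → ℕ) (ζ : ℕ → ZMod (2 * M + 1)) :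
    (t : ℕ) → (Fin t → V) → V → ℝ
  | 0, _, _ => 0
  | k + 1, p, a =>
    if k + 1 < 2 ^ D then
      (2 * walk (fun i => (ζ i).val) (k + 1) + o (p (Fin.last k)) : ℝ) / (4 * (2 * M * D + 1)) +
        if p (Fin.last k) = v ↔ a = v then 0 else 1 / 2
    else 0

/-- Before time `2 ^ D` the walk is at most `2 * M * D`, so the denominator keeps the walk part
below 1/2 and leaves 1/2 for the switch penalty. Beyond that time the bound is not available, whence
the cutoff in `walkLoss`. -/
theorem walkLoss_mem (M D : ℕ) (v : V) (o : V → ℕ) (ho : ∀ x, o x ≤ 2)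
    (ζ : ℕ → ZMod (2 * M + 1)) (t : ℕ) (p : Fin t → V) (a : V) :
    walkLoss M D v o ζ t p a ∈ Set.Icc (0 : ℝ) 1 := by
  have frac_mem : ∀ {k : ℕ}, k + 1 < 2 ^ D → ∀ b : V,
      (2 * walk (fun i => (ζ i).val) (k + 1) + o b : ℝ) / (4 * (2 * M * D + 1)) ∈
        Set.Icc (0 : ℝ) (1 / 2) := by
    intro k hk b
    have hw : walk (fun i => (ζ i).val) (k + 1) ≤ D * (2 * M) :=
      walk_le (fun i => Nat.lt_succ_iff.1 (val_lt M (ζ i))) hk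
    have hw' : (walk (fun i => (ζ i).val) (k + 1) : ℝ) ≤ D * (2 * M) := by exact_mod_cast hw
    have ho' : (o b : ℝ) ≤ 2 := by exact_mod_cast ho b
    refine ⟨by positivity, ?_⟩
    rw [div_le_iff₀ (by positivity)]
    linarith
  cases t with
  | zero => simp [walkLoss]
  | succ k =>
    simp only [walkLoss]
    split_ifs with h1 h2
    · have h := frac_mem h1 (p (Fin.last k))
      exact ⟨by linarith [h.1], by linarith [h.2]⟩
    · have h := frac_mem h1 (p (Fin.last k))
      exact ⟨by linarith [h.1], by linarith [h.2]⟩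
    · simp

/-- The multi-scale adversary. -/
noncomputable def walkAdversary (M D : ℕ) (v : V) (o : V → ℕ) (ho : ∀ x, o x ≤ 2)
    (ζ : ℕ → ZMod (2 * M + 1)) : LossSequence V where
  loss := walkLoss M D v o ζ
  loss_mem := walkLoss_mem M D v o ho ζ

theorem walkAdversary_hasMemory (M D : ℕ) (v : V) (o : V → ℕ) (ho : ∀ x, o x ≤ 2)
    (ζ : ℕ → ZMod (2 * M + 1)) : (walkAdversary M D v o ho ζ).HasMemory 1 := by
  intro t p q a h
  cases t with
  | zero => rfl
  | succ k =>
    have : p (Fin.last k) = q (Fin.last k) := h _ (by simp)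
    simp only [walkAdversary, walkLoss, this]

theorem walkLoss_congr (M D : ℕ) (v : V) (o : V → ℕ) {ζ ζ' : ℕ → ZMod (2 * M + 1)} {t : ℕ}
    (h : ∀ i < t, ζ i = ζ' i) (p : Fin t → V) (a : V) :
    walkLoss M D v o ζ t p a = walkLoss M D v o ζ' t p a := by
  cases t with
  | zero => rfl
  | succ k =>
    have : walk (fun i => (ζ i).val) (k + 1) = walk (fun i => (ζ' i).val) (k + 1) :=
      walk_congr _ fun i hi => by rw [h i hi]
    simp only [walkLoss, this]

/-- The number of switches between `v` and the other actions. -/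
def switches (v : V) {n : ℕ} (x : Fin (n + 1) → V) : ℝ :=
  ∑ k : Fin n, if x k.castSucc = v ↔ x k.succ = v then 0 else 1

/-- The walk does not depend on the actions and cancels against the constant comparator `w`, which
never switches. The initial round costs nothing. -/
theorem le_policyRegret_walkAdversary [Fintype V] (M : ℕ) {D n : ℕ} (hn : n < 2 ^ D) (v w : V)
    (o : V → ℕ) (ho : ∀ x, o x ≤ 2) (ζ : ℕ → ZMod (2 * M + 1)) (x : Fin (n + 1) → V) :
    (∑ k : Fin n, ((o (x k.castSucc) : ℝ) - o w)) / (4 * (2 * M * D + 1)) + switches v x / 2 ≤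
      policyRegret (walkAdversary M D v o ho ζ) x := by
  have h1 := iInf_le_of_fintype (fun a : V => ∑ t : Fin (n + 1),
    (walkAdversary M D v o ho ζ).loss t (fun _ => a) a) w
  unfold policyRegret
  refine le_trans (le_of_eq ?_) (sub_le_sub_left h1 _)
  rw [Fin.sum_univ_succ, Fin.sum_univ_succ, switches, Finset.sum_div, Finset.sum_div,
    ← Finset.sum_add_distrib]
  have e0 : ∀ (p : Fin ((0 : Fin (n + 1)) : ℕ) → V) a,
    (walkAdversary M D v o ho ζ).loss ((0 : Fin (n + 1)) : ℕ) p a = 0 := fun p a => rfl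
  rw [e0, e0, zero_add, zero_add, ← Finset.sum_sub_distrib]
  refine Finset.sum_congr rfl fun k _ => ?_
  have hk : (k : ℕ) + 1 < 2 ^ D := by have := k.2; omega
  have e1 : ∀ (p : Fin (k.succ : ℕ) → V) a, (walkAdversary M D v o ho ζ).loss (k.succ : ℕ) p a =
      (2 * walk (fun i => (ζ i).val) (k + 1) + o (p (Fin.last (k : ℕ))) : ℝ) /
          (4 * (2 * M * D + 1)) + if p (Fin.last (k : ℕ)) = v ↔ a = v then 0 else 1 / 2 :=
    fun p a => if_pos hk
  rw [e1, e1]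
  have e2 : past x k.succ (Fin.last (k : ℕ)) = x k.castSucc := rfl
  rw [e2, if_pos Iff.rfl]
  split_ifs <;> ring

end Adversary

/-! ### The lower bound -/

section Lower

variable {V : Type u}

/-- Feedback does not depend on losses of other rounds. -/
theorem feedback_congr (G : Digraph V) {f g : LossSequence V} {T : ℕ} (x : Fin T → V) (t : Fin T)
    (h : ∀ a, f.loss t (past x t) a = g.loss t (past x t) a) :
    feedback G f x t = feedback G g x t := by
  funext i
  simp only [feedback, h]

theorem playProb_congr [Fintype V] (G : Digraph V) (π : Strategy V) {f g : LossSequence V}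
    {T : ℕ} (x : Fin T → V)
    (h : ∀ (t : Fin T) a, f.loss t (past x t) a = g.loss t (past x t) a) :
    playProb G π f x = playProb G π g x := by
  rw [playProb_eq_histProb, playProb_eq_histProb]
  congr 1
  funext t
  exact feedback_congr G x t (h t)

variable [DecidableEq V]

/-! ### Labels of plays and the rounds that carry information -/

/-- The indicator of the action `v`. -/
def arm (v a : V) : ℕ := if a = v then 1 else 0

/-- The sequence that starts with `0` and continues with the indicators of `x k = v`. -/
def label (v : V) {t : ℕ} (x : Fin t → V) : ℕ → ℤ
  | 0 => 0
  | m + 1 => if h : m < t then arm v (x ⟨m, h⟩) else 0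

theorem label_past (v : V) {T : ℕ} (x : Fin T → V) (t : Fin T) {m : ℕ} (hm : m ≤ t) :
    label v (past x t) m = label v x m := by
  cases m with
  | zero => rfl
  | succ m =>
    have h1 : m < (t : ℕ) := hm
    simp only [label, h1, h1.trans t.2, dite_true]
    rfl

theorem label_succ (v : V) {T : ℕ} (x : Fin T → V) (t : Fin T) :
    label v x (t + 1) = arm v (x t) := by
  simp [label]

theorem label_mem (v : V) {T : ℕ} (x : Fin T → V) (m : ℕ) :
    label v x m = 0 ∨ label v x m = 1 := by
  cases m with
  | zero => exact Or.inl rfl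
  | succ m =>
    simp only [label, arm]
    split_ifs <;> simp

/-- The change of the label between the parent and the node of round `t`. -/
def labelChange (v : V) (t : ℕ) (x : Fin t → V) (a : V) : ℤ :=
  arm v a - label v x (parent (t + 1))

theorem labelChange_past (v : V) {T : ℕ} (x : Fin T → V) (t : Fin T) :
    labelChange v t (past x t) (x t) = label v x (t + 1) - label v x (parent (t + 1)) := by
  rw [labelChange, label_past v x t (parent_succ_le t), label_succ]

theorem labelChange_mem (v : V) (t : ℕ) (x : Fin t → V) (a : V) :
    labelChange v t x a = 0 ∨ labelChange v t x a = 1 ∨ labelChange v t x a = -1 := by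
  have h := label_mem v x (parent (t + 1))
  unfold labelChange arm
  split_ifs <;> rcases h with h | h <;> simp [h]

/-- Indicates whether the label changes between the parent and the node of round `t`. -/
noncomputable def visible (v : V) (t : ℕ) (x : Fin t → V) (a : V) : ℝ :=
  if labelChange v t x a = 0 then 0 else 1

theorem sum_visible_le (v : V) {n D : ℕ} (hn : n + 1 < 2 ^ D) (x : Fin (n + 1) → V) :
    ∑ t : Fin (n + 1), visible v t (past x t) (x t) ≤ D * (1 + switches v x) := by
  have h1 : ∑ t : Fin (n + 1), visible v t (past x t) (x t) =
      ∑ t ∈ Finset.range (n + 1),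
        if label v x (t + 1) = label v x (parent (t + 1)) then (0 : ℝ) else 1 := by
    rw [← Fin.sum_univ_eq_sum_range (fun t =>
      if label v x (t + 1) = label v x (parent (t + 1)) then (0 : ℝ) else 1)]
    refine Finset.sum_congr rfl fun t _ => ?_
    simp only [visible, labelChange_past, sub_eq_zero]
  rw [h1]
  refine (sum_parent_change_le hn (label v x)).trans ?_
  refine mul_le_mul_of_nonneg_left ?_ (Nat.cast_nonneg _)
  -- The term split off compares the conventional label 0 at time 0 with the first action; it
  -- accounts for the extra 1.
  rw [Finset.sum_range_succ', add_comm]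
  refine add_le_add (by split_ifs <;> simp) (le_of_eq ?_)
  rw [switches, ← Fin.sum_univ_eq_sum_range (fun t =>
      if label v x (t + 1 + 1) = label v x (t + 1) then (0 : ℝ) else 1)]
  refine Finset.sum_congr rfl fun k _ => ?_
  have e1 : label v x ((k : ℕ) + 1 + 1) = arm v (x k.succ) := label_succ v x k.succ
  have e2 : label v x ((k : ℕ) + 1) = arm v (x k.castSucc) := label_succ v x k.castSucc
  rw [e1, e2]
  unfold arm
  split_ifs <;> simp_all

/-- The affinity of the noise distribution and its translate. -/
theorem one_sub_le_affinity_shift {M : ℕ} (hM : 1 ≤ M) {d : ℤ} (hd : d = 0 ∨ d = 1 ∨ d = -1) :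
    1 - 5 / (M : ℝ) ^ 2 * (if d = 0 then 0 else 1) ≤
      ∑ z : ZMod (2 * M + 1), √(tentProb M z) * √(tentProb M (z + d)) := by
  rcases hd with rfl | rfl | rfl
  · simp only [Int.cast_zero, add_zero, if_true, mul_zero, sub_zero]
    simp_rw [Real.mul_self_sqrt (tentProb_nonneg M _), sum_tentProb hM]
    exact le_rfl
  · simpa using one_sub_le_affinity_tentProb hM
  · have h := one_sub_le_affinity_tentProb hM
    rw [← Equiv.sum_comp (Equiv.subRight (1 : ZMod (2 * M + 1)))] at h
    simpa [mul_comm, ← sub_eq_add_neg] using h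

/-- The tent vanishes at the adjacent residues `0` and `2 * M`, so a unit shift that lands in the
support has not wrapped around and is a shift of integers. -/
theorem val_add_of_tentProb_ne_zero {M : ℕ} (hM : 1 ≤ M) {d : ℤ}
    (hd : d = 0 ∨ d = 1 ∨ d = -1) {z : ZMod (2 * M + 1)} (h : tentProb M (z + d) ≠ 0) :
    ((z + d).val : ℤ) = z.val + d := by
  have h1 := val_pos_of_tentProb_ne_zero h
  have h2 := val_lt M z
  rcases hd with rfl | rfl | rfl
  · simp
  · have h3 := val_add_one_eq hM z
    simp only [Int.cast_one] at *
    split_ifs at h3 <;> omega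
  · have h3 := val_add_one_eq hM (z + ((-1 : ℤ) : ZMod (2 * M + 1)))
    have h4 : z + ((-1 : ℤ) : ZMod (2 * M + 1)) + 1 = z := by push_cast; ring
    rw [h4] at h3
    split_ifs at h3 <;> omega

/-- Extend finitely many values by `0`. -/
def extendZero {A : Type*} [Zero A] {t : ℕ} (ξ : Fin t → A) (i : ℕ) : A :=
  if h : i < t then ξ ⟨i, h⟩ else 0

theorem extendZero_apply {A : Type*} [Zero A] {t : ℕ} (ξ : Fin t → A) (i : Fin t) :
    extendZero ξ i = ξ i := by
  simp [extendZero]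

theorem extendZero_past {A : Type*} [Zero A] {T : ℕ} (ξ : Fin T → A) (t : Fin T) {i : ℕ}
    (h : i < t) : extendZero (past ξ t) i = extendZero ξ i := by
  simp only [extendZero, h, h.trans t.2, dite_true]
  rfl

/-- The offsets of the two random adversaries of the lower bound: for `b = true` the action `v` is
worse than all others, for `b = false` it is better. -/
def offset (v : V) (b : Bool) (a : V) : ℕ := if b then 1 + arm v a else 1 - arm v a

theorem offset_le_two (v : V) (b : Bool) (a : V) : offset v b a ≤ 2 := by
  unfold offset arm
  split_ifs <;> omega

/-! ### Coupling the two adversaries by translated noise -/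

variable [Fintype V] {M D : ℕ}

/-- The conditional distribution of the action in round `t`, as a function of the noise. -/
noncomputable def noisePlay (G : Digraph V) (π : Strategy V) (M D : ℕ) (v : V) (t : ℕ)
    (x : Fin t → V) (ξ : Fin t → ZMod (2 * M + 1)) (a : V) : ℝ :=
  π.prob t x (feedback G
    (walkAdversary M D v (offset v true) (offset_le_two v true) (extendZero ξ)) x) a

/-- The distribution of the noise. -/
noncomputable def noiseProb (M : ℕ) (t : ℕ) (_ : Fin t → V) (_ : V) (z : ZMod (2 * M + 1)) : ℝ :=
  tentProb M z

/-- The distribution of the noise for which the second adversary shows the same feedback as the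
first one. -/
noncomputable def shiftedNoiseProb (v : V) (M : ℕ) (t : ℕ) (x : Fin t → V) (a : V)
    (z : ZMod (2 * M + 1)) : ℝ :=
  tentProb M (z + labelChange v t x a)

/-- The loss of round `s` uses only noise of index below `s`, so the truncated noise yields the same
feedback. In particular `ξ t` enters the feedback only after action `t` is chosen, which is why its
law may depend on that action. -/
theorem prod_noisePlay (G : Digraph V) (π : Strategy V) (v : V) {T : ℕ} (x : Fin T → V)
    (ξ : Fin T → ZMod (2 * M + 1)) :
    ∏ t : Fin T, noisePlay G π M D v t (past x t) (past ξ t) (x t) =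
      playProb G π
        (walkAdversary M D v (offset v true) (offset_le_two v true) (extendZero ξ)) x := by
  refine Finset.prod_congr rfl fun t _ => ?_
  unfold noisePlay
  congr 1
  funext s
  have hs : (s : ℕ) < t := s.2
  refine feedback_congr G (past x t) s fun a => ?_
  exact walkLoss_congr M D v _ (fun i hi => extendZero_past ξ t (hi.trans hs)) _ _

/-- The change of labels along a play, as an element of the noise group. -/
def labelShift (v : V) (M : ℕ) {T : ℕ} (x : Fin T → V) (t : Fin T) : ZMod (2 * M + 1) :=
  (labelChange v t (past x t) (x t) : ℤ)

/-- Translating the increments by the label changes translates the walk by the labels, and this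
compensates the difference of the offsets in every loss along `x`. -/
theorem playProb_shift (hM : 1 ≤ M) (G : Digraph V) (π : Strategy V) (v : V) {T : ℕ}
    (x : Fin T → V) (ξ : Fin T → ZMod (2 * M + 1))
    (h : ∀ t, tentProb M ((ξ + labelShift v M x) t) ≠ 0) :
    playProb G π
        (walkAdversary M D v (offset v true) (offset_le_two v true) (extendZero ξ)) x =
      playProb G π
        (walkAdversary M D v (offset v false) (offset_le_two v false)
          (extendZero (ξ + labelShift v M x))) x := by
  have hwalk := walk_shift (ζ := fun i => (extendZero ξ i).val)
    (ζ' := fun i => (extendZero (ξ + labelShift v M x) i).val) (c := label v x) rfl (T := T)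
    (fun t ht => by
      have e1 := extendZero_apply ξ ⟨t, ht⟩
      have e2 := extendZero_apply (ξ + labelShift v M x) ⟨t, ht⟩
      simp only at e1 e2
      have e3 := labelChange_past v x ⟨t, ht⟩
      simp only at e3
      simp only [e1, e2]
      rw [← e3]
      exact val_add_of_tentProb_ne_zero hM (labelChange_mem v _ _ _) (h ⟨t, ht⟩))
  refine playProb_congr G π x fun t a => ?_
  obtain ⟨t, ht⟩ := t
  cases t with
  | zero => rfl
  | succ k =>
    have hk : k < T := by omega
    have e1 := hwalk (k + 1) ht.le
    have e2 : label v x (k + 1) = arm v (x ⟨k, hk⟩) := label_succ v x ⟨k, hk⟩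
    have e3 : past x ⟨k + 1, ht⟩ (Fin.last k) = x ⟨k, hk⟩ := rfl
    rw [e2] at e1
    have e4 : (walk (fun i => (extendZero (ξ + labelShift v M x) i).val) (k + 1) : ℝ) =
        walk (fun i => (extendZero ξ i).val) (k + 1) + arm v (x ⟨k, hk⟩) := by exact_mod_cast e1
    -- A walk unit has weight 2, the gap between the two offsets of `v`; the other actions have
    -- offset 1 in both worlds.
    have e5 : (offset v true (x ⟨k, hk⟩) : ℝ) =
        2 * arm v (x ⟨k, hk⟩) + offset v false (x ⟨k, hk⟩) := by
      by_cases hx : x ⟨k, hk⟩ = v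
      · norm_num [offset, arm, hx]
      · norm_num [offset, arm, hx]
    simp only [walkAdversary, walkLoss, e3, e4, e5]
    congr 3
    ring

theorem jointWeight_noiseProb (G : Digraph V) (π : Strategy V) (v : V) {T : ℕ} (x : Fin T → V)
    (ξ : Fin T → ZMod (2 * M + 1)) :
    jointWeight (noisePlay G π M D v) (noiseProb M) x ξ =
      playProb G π
          (walkAdversary M D v (offset v true) (offset_le_two v true) (extendZero ξ)) x *
        ∏ t, tentProb M (ξ t) := by
  rw [← prod_noisePlay, ← Finset.prod_mul_distrib]
  rfl

/-- The second experiment reuses the player's response to the first adversary. Wherever the noise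
has positive weight, the second adversary with translated noise shows the same feedback, so this is
a genuine play against it. -/
theorem jointWeight_shiftedNoiseProb (hM : 1 ≤ M) (G : Digraph V) (π : Strategy V) (v : V) {T : ℕ}
    (x : Fin T → V) (ξ : Fin T → ZMod (2 * M + 1)) :
    jointWeight (noisePlay G π M D v) (shiftedNoiseProb v M) x ξ =
      playProb G π
          (walkAdversary M D v (offset v false) (offset_le_two v false)
            (extendZero (ξ + labelShift v M x))) x *
        ∏ t, tentProb M ((ξ + labelShift v M x) t) := by
  have h1 : jointWeight (noisePlay G π M D v) (shiftedNoiseProb v M) x ξ =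
      playProb G π
          (walkAdversary M D v (offset v true) (offset_le_two v true) (extendZero ξ)) x *
        ∏ t, tentProb M ((ξ + labelShift v M x) t) := by
    rw [← prod_noisePlay, ← Finset.prod_mul_distrib]
    rfl
  rw [h1]
  by_cases h : ∏ t, tentProb M ((ξ + labelShift v M x) t) = 0
  · rw [h, mul_zero, mul_zero]
  · rw [playProb_shift hM G π v x ξ fun t => Finset.prod_ne_zero_iff.1 h t (Finset.mem_univ t)]

/-- The expectation of a lower bound for the regret is at most the worst expected regret. -/
theorem sum_playProb_mul_le (hM : 1 ≤ M) (G : Digraph V) (π : Strategy V) (v : V) (b : Bool)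
    {T : ℕ} {R : ℝ} (hR : ∀ f : LossSequence V, f.HasMemory 1 → expectedRegret G π f T ≤ R)
    (H : (Fin T → V) → ℝ)
    (hH : ∀ (ζ : ℕ → ZMod (2 * M + 1)) x,
      H x ≤ policyRegret (walkAdversary M D v (offset v b) (offset_le_two v b) ζ) x) :
    ∑ x : Fin T → V, ∑ ξ : Fin T → ZMod (2 * M + 1),
      playProb G π (walkAdversary M D v (offset v b) (offset_le_two v b) (extendZero ξ)) x *
        (∏ t, tentProb M (ξ t)) * H x ≤ R := by
  have hprod : ∑ ξ : Fin T → ZMod (2 * M + 1), ∏ t, tentProb M (ξ t) = 1 := by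
    have := Finset.prod_univ_sum (fun _ : Fin T => (Finset.univ : Finset (ZMod (2 * M + 1))))
      fun _ z => tentProb M z
    rw [Fintype.piFinset_univ] at this
    rw [← this]
    simp [sum_tentProb hM]
  rw [Finset.sum_comm]
  calc _ ≤ ∑ ξ : Fin T → ZMod (2 * M + 1), (∏ t, tentProb M (ξ t)) * R := by
        refine Finset.sum_le_sum fun ξ _ => ?_
        have h0 : 0 ≤ ∏ t, tentProb M (ξ t) := Finset.prod_nonneg fun _ _ => tentProb_nonneg _ _
        refine le_trans ?_ (mul_le_mul_of_nonneg_left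
          (hR _ (walkAdversary_hasMemory M D v (offset v b) (offset_le_two v b) (extendZero ξ))) h0)
        rw [expectedRegret, Finset.mul_sum]
        refine Finset.sum_le_sum fun x _ => ?_
        have h1 := mul_le_mul_of_nonneg_left (hH (extendZero ξ) x)
          (mul_nonneg (playProb_nonneg G π
            (walkAdversary M D v (offset v b) (offset_le_two v b) (extendZero ξ)) x) h0)
        linarith
    _ = R := by rw [← Finset.sum_mul, hprod, one_mul]

theorem sum_jointWeight_noiseProb_mul_le (hM : 1 ≤ M) (G : Digraph V) (π : Strategy V) (v : V)
    {T : ℕ} {R : ℝ} (hR : ∀ f : LossSequence V, f.HasMemory 1 → expectedRegret G π f T ≤ R)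
    (H : (Fin T → V) → ℝ)
    (hH : ∀ (ζ : ℕ → ZMod (2 * M + 1)) x,
      H x ≤ policyRegret (walkAdversary M D v (offset v true) (offset_le_two v true) ζ) x) :
    ∑ x : Fin T → V, ∑ ξ : Fin T → ZMod (2 * M + 1),
      jointWeight (noisePlay G π M D v) (noiseProb M) x ξ * H x ≤ R := by
  simp only [jointWeight_noiseProb]
  exact sum_playProb_mul_le hM G π v true hR H hH

/-- For a fixed play `x`, adding `labelShift v M x` is a bijection of the noise, which undoes the
translation. -/
theorem sum_jointWeight_shiftedNoiseProb_mul_le (hM : 1 ≤ M) (G : Digraph V) (π : Strategy V)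
    (v : V) {T : ℕ} {R : ℝ}
    (hR : ∀ f : LossSequence V, f.HasMemory 1 → expectedRegret G π f T ≤ R)
    (H : (Fin T → V) → ℝ)
    (hH : ∀ (ζ : ℕ → ZMod (2 * M + 1)) x,
      H x ≤ policyRegret (walkAdversary M D v (offset v false) (offset_le_two v false) ζ) x) :
    ∑ x : Fin T → V, ∑ ξ : Fin T → ZMod (2 * M + 1),
      jointWeight (noisePlay G π M D v) (shiftedNoiseProb v M) x ξ * H x ≤ R := by
  refine le_trans (le_of_eq ?_) (sum_playProb_mul_le hM G π v false hR H hH)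
  refine Finset.sum_congr rfl fun x _ => ?_
  simp only [jointWeight_shiftedNoiseProb hM]
  exact Equiv.sum_comp (Equiv.addRight (labelShift v M x))
    (fun ξ : Fin T → ZMod (2 * M + 1) => playProb G π
      (walkAdversary M D v (offset v false) (offset_le_two v false) (extendZero ξ)) x *
        (∏ t, tentProb M (ξ t)) * H x)

/-- The lower bound for the regret with free parameters. -/
theorem regret_lower_bound (hM : 1 ≤ M) (G : Digraph V) (π : Strategy V) {v w : V} (hvw : w ≠ v)
    {n : ℕ} (hn : n + 1 < 2 ^ D) {R : ℝ}
    (hR : ∀ f : LossSequence V, f.HasMemory 1 → expectedRegret G π f (n + 1) ≤ R) :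
    (n : ℝ) / (64 * (2 * M * D + 1)) ≤ R ∨ (M : ℝ) ^ 2 / (20 * D) ≤ R + 1 / 2 := by
  have hD : D ≠ 0 := by
    rintro rfl
    simp at hn
  have hD0 : (0 : ℝ) < D := by exact_mod_cast Nat.pos_of_ne_zero hD
  have hM0 : (0 : ℝ) < M := by exact_mod_cast hM
  have hn' : n < 2 ^ D := n.lt_succ_self.trans hn
  set S : ℝ := 4 * (2 * M * D + 1) with hS
  have hS0 : 0 < S := by positivity
  set q := noisePlay G π M D v with hq_def
  set w₁ : (Fin (n + 1) → V) → (Fin (n + 1) → ZMod (2 * M + 1)) → ℝ :=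
    fun x ξ => jointWeight q (noiseProb M) x ξ with hw₁
  set w₂ : (Fin (n + 1) → V) → (Fin (n + 1) → ZMod (2 * M + 1)) → ℝ :=
    fun x ξ => jointWeight q (shiftedNoiseProb v M) x ξ with hw₂
  have hq : ∀ t x ξ a, 0 ≤ q t x ξ a := fun t x ξ a => π.prob_nonneg _ _ _ _
  have hq1 : ∀ t x ξ, ∑ a, q t x ξ a = 1 := fun t x ξ => π.prob_sum _ _ _
  have hp₁ : ∀ t (x : Fin t → V) a z, 0 ≤ noiseProb M t x a z :=
    fun t x a z => tentProb_nonneg _ _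
  have hp₂ : ∀ t (x : Fin t → V) a z, 0 ≤ shiftedNoiseProb v M t x a z :=
    fun t x a z => tentProb_nonneg _ _
  have hp₁1 : ∀ t (x : Fin t → V) a, ∑ z, noiseProb M t x a z = 1 := fun t x a => sum_tentProb hM
  have hp₂1 : ∀ t (x : Fin t → V) a, ∑ z, shiftedNoiseProb v M t x a z = 1 :=
    fun t x a => sum_tentProb_add hM _
  have hw₁0 : ∀ x ξ, 0 ≤ w₁ x ξ := jointWeight_nonneg hq hp₁
  have hw₂0 : ∀ x ξ, 0 ≤ w₂ x ξ := jointWeight_nonneg hq hp₂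
  have hw₁1 : ∑ x, ∑ ξ, w₁ x ξ = 1 := sum_jointWeight hq1 hp₁1 (n + 1)
  have hw₂1 : ∑ x, ∑ ξ, w₂ x ξ = 1 := sum_jointWeight hq1 hp₂1 (n + 1)
  set N : (Fin (n + 1) → V) → ℝ := fun x => ∑ k : Fin n, (arm v (x k.castSucc) : ℝ) with hN
  have harm : ∀ a : V, (arm v a : ℝ) ∈ Set.Icc (0 : ℝ) 1 := by
    intro a
    unfold arm
    split_ifs <;> simp
  have hN0 : ∀ x, 0 ≤ N x := fun x => Finset.sum_nonneg fun k _ => (harm _).1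
  have hN1 : ∀ x, N x ≤ n := fun x => by
    calc N x ≤ ∑ _k : Fin n, (1 : ℝ) := Finset.sum_le_sum fun k _ => (harm _).2
      _ = n := by simp
  have hsw : ∀ x : Fin (n + 1) → V, 0 ≤ switches v x := fun x =>
    Finset.sum_nonneg fun k _ => by split_ifs <;> simp
  have reg₁ : ∑ x, ∑ ξ, w₁ x ξ * (N x / S + switches v x / 2) ≤ R := by
    refine sum_jointWeight_noiseProb_mul_le hM G π v hR _ fun ζ x => ?_
    refine le_trans (le_of_eq ?_) (le_policyRegret_walkAdversary M hn' v w _ _ ζ x)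
    congr 2
    refine Finset.sum_congr rfl fun k _ => ?_
    simp [offset, arm, hvw]
  have reg₂ : ∑ x, ∑ ξ, w₂ x ξ * ((n - N x) / S + switches v x / 2) ≤ R := by
    refine sum_jointWeight_shiftedNoiseProb_mul_le hM G π v hR _ fun ζ x => ?_
    refine le_trans (le_of_eq ?_) (le_policyRegret_walkAdversary M hn' v v _ _ ζ x)
    congr 2
    have h1 : (n : ℝ) = ∑ _k : Fin n, (1 : ℝ) := by simp
    rw [h1, hN, ← Finset.sum_sub_distrib]
    refine Finset.sum_congr rfl fun k _ => ?_
    by_cases hx : x k.castSucc = v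
    · simp [offset, arm, hx]
    · simp [offset, arm, hx]
  -- At most `D * (1 + switches)` rounds are informative, and since a switch costs 1/2, the expected
  -- number of switches is at most `2 * R`.
  have hvis : ∀ w' : (Fin (n + 1) → V) → (Fin (n + 1) → ZMod (2 * M + 1)) → ℝ,
      (∀ x ξ, 0 ≤ w' x ξ) → ∑ x, ∑ ξ, w' x ξ = 1 → ∀ h : (Fin (n + 1) → V) → ℝ, (∀ x, 0 ≤ h x) →
      ∑ x, ∑ ξ, w' x ξ * (h x / S + switches v x / 2) ≤ R →
      ∑ x, ∑ ξ, w' x ξ * ∑ t : Fin (n + 1), visible v t (past x t) (x t) ≤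
        D * (1 + 2 * R) := by
    intro w' hw' hw'1 h hh hreg
    calc _ ≤ ∑ x, ∑ ξ, (D * w' x ξ + 2 * D * (w' x ξ * (h x / S + switches v x / 2))) := by
          refine Finset.sum_le_sum fun x _ => Finset.sum_le_sum fun ξ _ => ?_
          have h1 := mul_le_mul_of_nonneg_left (sum_visible_le v hn x) (hw' x ξ)
          have h2 : 0 ≤ D * (w' x ξ * (h x / S)) :=
            mul_nonneg hD0.le (mul_nonneg (hw' x ξ) (div_nonneg (hh x) hS0.le))
          linarith
      _ = D * ∑ x, ∑ ξ, w' x ξ +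
          2 * D * ∑ x, ∑ ξ, w' x ξ * (h x / S + switches v x / 2) := by
          simp only [Finset.sum_add_distrib, Finset.mul_sum]
      _ ≤ _ := by
          rw [hw'1]
          have := mul_le_mul_of_nonneg_left hreg (by positivity : (0 : ℝ) ≤ 2 * D)
          linarith
  have vis₁ := hvis w₁ hw₁0 hw₁1 N hN0 reg₁
  have vis₂ := hvis w₂ hw₂0 hw₂1 (fun x => n - N x) (fun x => sub_nonneg.2 (hN1 x)) reg₂
  have haff := one_le_affinity_add hq hq1 hp₁ hp₁1 hp₂ hp₂1 (visible v)
    (fun t x a => by unfold visible; split_ifs <;> simp) (κ := 5 / (M : ℝ) ^ 2) (by positivity)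
    (fun t x a => one_sub_le_affinity_shift hM (labelChange_mem v t x a)) (n + 1)
  change 1 ≤ ∑ x, ∑ ξ, √(w₁ x ξ) * √(w₂ x ξ) + 5 / (M : ℝ) ^ 2 / 2 *
    (∑ x, ∑ ξ, w₁ x ξ * ∑ t : Fin (n + 1), visible v t (past x t) (x t) +
      ∑ x, ∑ ξ, w₂ x ξ * ∑ t : Fin (n + 1), visible v t (past x t) (x t)) at haff
  have haff' : 1 ≤ ∑ x, ∑ ξ, √(w₁ x ξ) * √(w₂ x ξ) + 5 / (M : ℝ) ^ 2 * (D * (1 + 2 * R)) := by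
    have := mul_le_mul_of_nonneg_left (add_le_add vis₁ vis₂)
      (by positivity : (0 : ℝ) ≤ 5 / (M : ℝ) ^ 2 / 2)
    linarith
  -- Either the informative rounds consume half of the affinity, which forces many switches, or
  -- affinity 1/2 remains and gives overlap 1/8.
  by_cases hbig : 1 / 2 ≤ 5 / (M : ℝ) ^ 2 * (D * (1 + 2 * R))
  · right
    rw [div_mul_eq_mul_div, le_div_iff₀ (by positivity)] at hbig
    rw [div_le_iff₀ (by positivity)]
    linarith
  · left
    have h1 : 1 / 2 ≤ ∑ x, ∑ ξ, √(w₁ x ξ) * √(w₂ x ξ) := by linarith [not_le.1 hbig]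
    have h2 := sq_affinity_le_two_mul_overlap
      (fun i : (Fin (n + 1) → V) × (Fin (n + 1) → ZMod (2 * M + 1)) => w₁ i.1 i.2)
      (fun i => w₂ i.1 i.2) (fun i => hw₁0 _ _) (fun i => hw₂0 _ _)
      (by rw [Fintype.sum_prod_type]; exact hw₁1) (by rw [Fintype.sum_prod_type]; exact hw₂1)
    rw [Fintype.sum_prod_type, Fintype.sum_prod_type] at h2
    simp only at h2
    have h3 : 1 / 8 ≤ ∑ x, ∑ ξ, min (w₁ x ξ) (w₂ x ξ) := by nlinarith
    -- A history in the overlap pays `N x / S` in one world and `(n - N x) / S` in the other, in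
    -- total `n / S` whatever was played.
    have h4 : n / S * ∑ x, ∑ ξ, min (w₁ x ξ) (w₂ x ξ) ≤
        ∑ x, ∑ ξ, w₁ x ξ * (N x / S + switches v x / 2) +
          ∑ x, ∑ ξ, w₂ x ξ * ((n - N x) / S + switches v x / 2) := by
      rw [← Finset.sum_add_distrib, Finset.mul_sum]
      refine Finset.sum_le_sum fun x _ => ?_
      rw [← Finset.sum_add_distrib, Finset.mul_sum]
      refine Finset.sum_le_sum fun ξ _ => ?_
      have a1 : 0 ≤ N x / S := div_nonneg (hN0 x) hS0.le
      have a2 : 0 ≤ (n - N x) / S := div_nonneg (sub_nonneg.2 (hN1 x)) hS0.le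
      have a3 := hsw x
      have a4 : n / S = N x / S + (n - N x) / S := by ring
      rw [a4, add_mul]
      refine add_le_add ?_ ?_
      · rw [mul_comm]
        exact mul_le_mul (min_le_left _ _) (by linarith) a1 (hw₁0 _ _)
      · rw [mul_comm]
        exact mul_le_mul (min_le_right _ _) (by linarith) a2 (hw₂0 _ _)
    have h5 : n / S * (1 / 8) ≤ 2 * R := by
      have := mul_le_mul_of_nonneg_left h3 (by positivity : (0 : ℝ) ≤ n / S)
      linarith
    have h6 : (n : ℝ) / (64 * (2 * M * D + 1)) = n / S * (1 / 8) / 2 := by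
      rw [hS]
      field_simp
      ring
    linarith

end Lower

/-! ### Choice of parameters in the lower bound -/

theorem rpow_two_thirds {T : ℝ} (hT : 0 ≤ T) : T ^ ((2 : ℝ) / 3) = (T ^ ((1 : ℝ) / 3)) ^ 2 := by
  rw [← Real.rpow_natCast, ← Real.rpow_mul hT]
  norm_num

theorem rpow_one_third_pow {T : ℝ} (hT : 0 ≤ T) : (T ^ ((1 : ℝ) / 3)) ^ 3 = T := by
  rw [← Real.rpow_natCast, ← Real.rpow_mul hT]
  norm_num

theorem natLog_succ_le {T : ℕ} (hT : 3 ≤ T) : ((Nat.log 2 T + 1 : ℕ) : ℝ) ≤ 3 * Real.log T := by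
  have h1 : ((2 : ℝ) ^ Nat.log 2 T) ≤ T := by exact_mod_cast Nat.pow_log_le_self 2 (by omega)
  have h2 := Real.log_le_log (by positivity) h1
  rw [Real.log_pow] at h2
  have h3 := Real.log_two_gt_d9
  have h4 : 1 ≤ Real.log T := by
    rw [Real.le_log_iff_exp_le (by positivity)]
    have : (3 : ℝ) ≤ T := by exact_mod_cast hT
    linarith [Real.exp_one_lt_d9]
  push_cast
  nlinarith [(Nat.cast_nonneg (Nat.log 2 T) : (0 : ℝ) ≤ _)]

/-- For such `T` the main term is at least 1, so it absorbs the additive 1/2 in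
`regret_lower_bound`. The 60 comes from `20 * D` with `D ≤ 3 * log T`. -/
theorem exists_log_le_rpow :
    ∃ T₀ : ℕ, 3 ≤ T₀ ∧ ∀ T : ℕ, T₀ ≤ T → 60 * Real.log T ≤ (T : ℝ) ^ ((2 : ℝ) / 3) := by
  have h := (isLittleO_log_rpow_atTop (by norm_num : (0 : ℝ) < 2 / 3)).bound
    (by norm_num : (0 : ℝ) < 1 / 60)
  have h' := (tendsto_natCast_atTop_atTop (R := ℝ)).eventually h
  obtain ⟨T₀, hT₀⟩ := Filter.eventually_atTop.1 h'
  refine ⟨max T₀ 3, le_max_right _ _, fun T hT => ?_⟩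
  have h1 := hT₀ T ((le_max_left _ _).trans hT)
  rw [Real.norm_eq_abs, Real.norm_of_nonneg (Real.rpow_nonneg (Nat.cast_nonneg T) _)] at h1
  linarith [le_abs_self (Real.log T)]

instance (V : Type u) [Fintype V] [Nonempty V] : Nonempty (Strategy V) := by
  classical
  exact ⟨Strategy.quantized 1 fun _ _ => Classical.arbitrary V⟩

theorem exists_minimaxRegret_lower_bound :
    ∃ c : ℝ, 0 < c ∧ ∃ T₀ : ℕ, ∀ (V : Type u) [Fintype V] (G : Digraph V),
      2 ≤ Fintype.card V → ∀ T : ℕ, T₀ ≤ T →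
        c * (T : ℝ) ^ ((2 : ℝ) / 3) / Real.log T ≤ minimaxRegret G 1 T := by
  obtain ⟨T₀, hT₀3, hT₀⟩ := exists_log_le_rpow
  refine ⟨1 / 2304, by norm_num, T₀, fun V _ G hV T hT => ?_⟩
  classical
  obtain ⟨v, w, hvw⟩ := Fintype.exists_pair_of_one_lt_card (by omega : 1 < Fintype.card V)
  have : Nonempty V := ⟨v⟩
  refine le_ciInf fun π => ?_
  set R := ⨆ f : {f : LossSequence V // f.HasMemory 1}, expectedRegret G π f.1 T with hRdef
  have hR : ∀ f : LossSequence V, f.HasMemory 1 → expectedRegret G π f T ≤ R :=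
    fun f hf => expectedRegret_le_iSup G π f hf T
  have hT3 : 3 ≤ T := hT₀3.trans hT
  have hlogx := hT₀ T hT
  have hTpos : (0 : ℝ) ≤ T := Nat.cast_nonneg T
  have hT3' : (3 : ℝ) ≤ T := by exact_mod_cast hT3
  rw [rpow_two_thirds hTpos] at *
  set x := (T : ℝ) ^ ((1 : ℝ) / 3) with hx
  have hx3 : x ^ 3 = T := rpow_one_third_pow hTpos
  have hx1 : 1 ≤ x := Real.one_le_rpow (by linarith) (by norm_num)
  set M := ⌈x⌉₊ with hM
  have hM1 : x ≤ M := Nat.le_ceil x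
  have hM2 : (M : ℝ) ≤ 2 * x := by linarith [Nat.ceil_lt_add_one (by linarith : 0 ≤ x)]
  have hM0 : 1 ≤ M := by exact_mod_cast hx1.trans hM1
  set D := Nat.log 2 T + 1 with hD
  have hD1 : (1 : ℝ) ≤ D := by exact_mod_cast Nat.le_add_left 1 _
  have hDlog : (D : ℝ) ≤ 3 * Real.log T := natLog_succ_le hT3
  have hlog : 0 < Real.log T := by linarith
  obtain ⟨n, rfl⟩ : ∃ n, T = n + 1 := ⟨T - 1, by omega⟩
  have hn : n + 1 < 2 ^ D := Nat.lt_pow_succ_log_self (by norm_num) _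
  rcases regret_lower_bound hM0 G π (v := v) (w := w) hvw.symm hn hR with h | h
  · refine le_trans ?_ h
    -- Since `M * D ≥ 1`, the left side is at most `192 * M * D`, and `M * D ≤ 6 * x * log T`.
    have h1 : 64 * (2 * (M : ℝ) * D + 1) ≤ 1152 * x * Real.log (n + 1 : ℕ) := by
      have a1 : (M : ℝ) * D ≤ 2 * x * (3 * Real.log (n + 1 : ℕ)) :=
        mul_le_mul hM2 hDlog (by linarith) (by linarith)
      have a2 : 1 ≤ (M : ℝ) * D := one_le_mul_of_one_le_of_one_le (hx1.trans hM1) hD1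
      linarith
    have h2 : x ^ 3 / 2 ≤ n := by
      rw [hx3]
      push_cast at hT3' ⊢
      linarith
    have hx0 : x ≠ 0 := by linarith
    calc 1 / 2304 * x ^ 2 / Real.log (n + 1 : ℕ) =
          (x ^ 3 / 2) / (1152 * x * Real.log (n + 1 : ℕ)) := by
          field_simp
          ring
      _ ≤ (n : ℝ) / (64 * (2 * (M : ℝ) * D + 1)) :=
          div_le_div₀ (Nat.cast_nonneg n) h2 (by positivity) h1
  · have h1 : x ^ 2 / (60 * Real.log (n + 1 : ℕ)) ≤ (M : ℝ) ^ 2 / (20 * D) :=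
      div_le_div₀ (by positivity) (by nlinarith) (by positivity) (by linarith)
    have h2 : 1 ≤ x ^ 2 / (60 * Real.log (n + 1 : ℕ)) := by
      rw [le_div_iff₀ (by positivity)]
      linarith
    have h3 : 1 / 2304 * x ^ 2 / Real.log (n + 1 : ℕ) =
        x ^ 2 / (60 * Real.log (n + 1 : ℕ)) * (60 / 2304) := by
      field_simp
    linarith

/-! ### Following the perturbed leader -/

section Leader

variable {V : Type*} {lead : (V → ℝ) → V}

/-- Compare `v` with the new leader before and after the change: their perturbed gap moves by at
most 1, as their noise off `v` agrees. -/
theorem noise_le_of_lead {L : ℕ} (hlead : ∀ (c : V → ℝ) v, c (lead c) ≤ c v) {c l : V → ℝ}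
    (hl : ∀ v, l v ∈ Set.Icc (0 : ℝ) 1) {v : V} {n n' : V → Fin L}
    (hn : lead (fun u => c u - (n u : ℕ)) = v) (hn' : lead (fun u => c u + l u - (n' u : ℕ)) ≠ v)
    (hoff : ∀ u, u ≠ v → n u = n' u) : (n' v : ℕ) ≤ n v + 1 := by
  have h1 := hlead (fun u => c u - (n u : ℕ)) (lead fun u => c u + l u - (n' u : ℕ))
  have h2 := hlead (fun u => c u + l u - (n' u : ℕ)) v
  simp only [hn] at h1
  rw [hoff _ hn'] at h1
  have h3 := (hl v).2
  have h4 := (hl (lead fun u => c u + l u - (n' u : ℕ))).1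
  have h5 : ((n' v : ℕ) : ℝ) ≤ (n v : ℕ) + 1 := by linarith
  exact_mod_cast h5

/-- The cumulative losses before round `j`, perturbed by `n`. -/
def perturbed {L : ℕ} (l : ℕ → V → ℝ) (n : V → Fin L) (j : ℕ) (v : V) : ℝ :=
  ∑ i ∈ Finset.range j, l i v - (n v : ℕ)

/-- Knowing the loss of the current round in advance beats the best fixed action; only the initial
perturbation, at most `L`, is lost. -/
theorem be_the_leader {L : ℕ} (hlead : ∀ (c : V → ℝ) v, c (lead c) ≤ c v) (l : ℕ → V → ℝ)
    (n : V → Fin L) (J : ℕ) :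
    ∑ j ∈ Finset.range J, l j (lead (perturbed l n (j + 1))) - L ≤
      perturbed l n J (lead (perturbed l n J)) := by
  induction J with
  | zero =>
    simp [perturbed]
  | succ J ih =>
    have h1 := hlead (perturbed l n J) (lead (perturbed l n (J + 1)))
    have h2 : perturbed l n (J + 1) (lead (perturbed l n (J + 1))) =
        perturbed l n J (lead (perturbed l n (J + 1))) + l J (lead (perturbed l n (J + 1))) := by
      conv_lhs => rw [perturbed, Finset.sum_range_succ]
      rw [perturbed]
      ring
    rw [Finset.sum_range_succ, h2]
    linarith

variable [Fintype V] [DecidableEq V]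

/-- With the noise off `v` fixed, any two values of `n v` at which `v` loses the lead differ by at
most 1. So there are at most two of them, told apart by parity; re-drawing `n v` freely while
recording its parity is injective. -/
theorem card_lead_change_at_le {L : ℕ} (hlead : ∀ (c : V → ℝ) v, c (lead c) ≤ c v) {c l : V → ℝ}
    (hl : ∀ v, l v ∈ Set.Icc (0 : ℝ) 1) (v : V) :
    (Finset.univ.filter fun n : V → Fin L => lead (fun u => c u - (n u : ℕ)) = v ∧
        lead (fun u => c u + l u - (n u : ℕ)) ≠ v).card * L ≤
      Fintype.card (V → Fin L) * 2 := by
  set S := Finset.univ.filter fun n : V → Fin L => lead (fun u => c u - (n u : ℕ)) = v ∧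
        lead (fun u => c u + l u - (n u : ℕ)) ≠ v with hS
  have hmem : ∀ n, n ∈ S ↔ lead (fun u => c u - (n u : ℕ)) = v ∧
        lead (fun u => c u + l u - (n u : ℕ)) ≠ v := fun n => by simp [hS]
  have h1 : (S ×ˢ (Finset.univ : Finset (Fin L))).card ≤
      (Finset.univ : Finset ((V → Fin L) × Fin 2)).card := by
    refine Finset.card_le_card_of_injOn
      (fun p => (Function.update p.1 v p.2, Fin.ofNat 2 (p.1 v))) (by simp) ?_
    rintro ⟨n, a⟩ hp ⟨n', a'⟩ hp' heq
    have hn := (hmem n).1 (Finset.mem_product.1 hp).1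
    have hn' := (hmem n').1 (Finset.mem_product.1 hp').1
    simp only [Prod.mk.injEq] at heq
    obtain ⟨e1, e2⟩ := heq
    have ha : a = a' := by simpa using congrFun e1 v
    have hoff : ∀ u, u ≠ v → n u = n' u := fun u hu => by
      simpa [Function.update_of_ne hu] using congrFun e1 u
    have b1 := noise_le_of_lead hlead hl hn.1 hn'.2 hoff
    have b2 := noise_le_of_lead hlead hl hn'.1 hn.2 fun u hu => (hoff u hu).symm
    have e3 : (n v : ℕ) % 2 = (n' v : ℕ) % 2 := by
      have := congrArg Fin.val e2
      simpa [Fin.ofNat] using this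
    have hv : n v = n' v := Fin.ext (by omega)
    have hnn : n = n' := by
      funext u
      by_cases hu : u = v
      · rw [hu, hv]
      · exact hoff u hu
    rw [hnn, ha]
  simpa [Finset.card_product] using h1

/-- The leader is stable under bounded changes of the losses, for most perturbations. -/
theorem card_lead_change_le {L : ℕ} (hlead : ∀ (c : V → ℝ) v, c (lead c) ≤ c v) {c l : V → ℝ}
    (hl : ∀ v, l v ∈ Set.Icc (0 : ℝ) 1) :
    (Finset.univ.filter fun n : V → Fin L => lead (fun u => c u - (n u : ℕ)) ≠
        lead (fun u => c u + l u - (n u : ℕ))).card * L ≤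
      Fintype.card V * (Fintype.card (V → Fin L) * 2) := by
  have h1 : (Finset.univ.filter fun n : V → Fin L => lead (fun u => c u - (n u : ℕ)) ≠
        lead (fun u => c u + l u - (n u : ℕ))) ⊆
      Finset.univ.biUnion fun v => Finset.univ.filter fun n : V → Fin L =>
        lead (fun u => c u - (n u : ℕ)) = v ∧ lead (fun u => c u + l u - (n u : ℕ)) ≠ v := by
    intro n hn
    simp only [Finset.mem_filter, Finset.mem_univ, true_and, Finset.mem_biUnion] at hn ⊢
    exact ⟨_, rfl, fun h => hn h.symm⟩
  calc _ ≤ (∑ v, (Finset.univ.filter fun n : V → Fin L => lead (fun u => c u - (n u : ℕ)) = v ∧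
        lead (fun u => c u + l u - (n u : ℕ)) ≠ v).card) * L :=
        Nat.mul_le_mul_right _ ((Finset.card_le_card h1).trans Finset.card_biUnion_le)
    _ ≤ ∑ _v : V, Fintype.card (V → Fin L) * 2 := by
        rw [Finset.sum_mul]
        exact Finset.sum_le_sum fun v _ => card_lead_change_at_le hlead hl v
    _ = _ := by simp

/-- The regret of following the perturbed leader. -/
theorem sum_perturbed_leader_le {L : ℕ} (hL : 0 < L) (hlead : ∀ (c : V → ℝ) v, c (lead c) ≤ c v)
    (l : ℕ → V → ℝ) (hl : ∀ j v, l j v ∈ Set.Icc (0 : ℝ) 1) (J : ℕ) (v : V) :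
    ∑ n : V → Fin L, ∑ j ∈ Finset.range J, l j (lead (perturbed l n j)) ≤
      Fintype.card (V → Fin L) *
        (∑ j ∈ Finset.range J, l j v + L + 2 * Fintype.card V * J / L) := by
  have hL0 : (0 : ℝ) < L := by exact_mod_cast hL
  have hstab : ∀ j, ∑ n : V → Fin L, l j (lead (perturbed l n j)) ≤
      ∑ n : V → Fin L, l j (lead (perturbed l n (j + 1))) +
        Fintype.card V * (Fintype.card (V → Fin L) * 2) / L := by
    intro j
    have hcard := card_lead_change_le (L := L) hlead (c := fun u => ∑ i ∈ Finset.range j, l i u)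
      (hl j)
    have hsucc : ∀ n : V → Fin L, perturbed l n (j + 1) =
        fun u => ∑ i ∈ Finset.range j, l i u + l j u - (n u : ℕ) := fun n => by
      funext u
      rw [perturbed, Finset.sum_range_succ]
    have h1 : ∀ n : V → Fin L, l j (lead (perturbed l n j)) ≤
        l j (lead (perturbed l n (j + 1))) +
          if lead (perturbed l n j) ≠ lead (perturbed l n (j + 1)) then 1 else 0 := by
      intro n
      split_ifs with h
      · linarith [(hl j (lead (perturbed l n j))).2, (hl j (lead (perturbed l n (j + 1)))).1]
      · rw [not_not.1 h]
        linarith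
    refine (Finset.sum_le_sum fun n _ => h1 n).trans ?_
    rw [Finset.sum_add_distrib, Finset.sum_boole]
    refine add_le_add le_rfl ?_
    rw [le_div_iff₀ hL0]
    simp only [hsucc]
    exact_mod_cast hcard
  have hbtl : ∀ n : V → Fin L, ∑ j ∈ Finset.range J, l j (lead (perturbed l n (j + 1))) ≤
      ∑ j ∈ Finset.range J, l j v + L := by
    intro n
    have h1 := be_the_leader hlead l n J
    have h2 := hlead (perturbed l n J) v
    have h3 : perturbed l n J v ≤ ∑ j ∈ Finset.range J, l j v :=
      sub_le_self _ (Nat.cast_nonneg _)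
    linarith
  rw [Finset.sum_comm]
  calc _ ≤ ∑ j ∈ Finset.range J, (∑ n : V → Fin L, l j (lead (perturbed l n (j + 1))) +
        Fintype.card V * (Fintype.card (V → Fin L) * 2) / L : ℝ) :=
        Finset.sum_le_sum fun j _ => hstab j
    _ = ∑ n : V → Fin L, ∑ j ∈ Finset.range J, l j (lead (perturbed l n (j + 1))) +
        J * (Fintype.card V * (Fintype.card (V → Fin L) * 2) / L) := by
        rw [Finset.sum_add_distrib, Finset.sum_comm]
        simp
    _ ≤ ∑ _n : V → Fin L, (∑ j ∈ Finset.range J, l j v + L) +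
        J * (Fintype.card V * (Fintype.card (V → Fin L) * 2) / L) :=
        add_le_add (Finset.sum_le_sum fun n _ => hbtl n) le_rfl
    _ = _ := by
        rw [Finset.sum_const, Finset.card_univ, nsmul_eq_mul]
        ring

end Leader

/-! ### Averages over independent seeds -/

/-- Exchanging the coordinate `s i` with the fresh value `b` is an involution. -/
theorem sum_update_eq {ι S : Type*} [Fintype ι] [DecidableEq ι] [Fintype S]
    (F : (ι → S) → ℝ) (i : ι) :
    ∑ s : ι → S, ∑ b : S, F (Function.update s i b) = Fintype.card S * ∑ s : ι → S, F s := by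
  let e : (ι → S) × S ≃ (ι → S) × S :=
    { toFun := fun p => (Function.update p.1 i p.2, p.1 i)
      invFun := fun p => (Function.update p.1 i p.2, p.1 i)
      left_inv := fun p => by simp
      right_inv := fun p => by simp }
  have h := e.sum_comp fun p => F p.1
  rw [Fintype.sum_prod_type, Fintype.sum_prod_type] at h
  refine h.trans ?_
  simp [Finset.mul_sum]

/-- A coordinate that `h` does not depend on may be averaged. -/
theorem sum_apply_eq_of_update {ι S A : Type*} [Fintype ι] [DecidableEq ι] [Fintype S]
    (i : ι) (h : (ι → S) → A) (hh : ∀ s b, h (Function.update s i b) = h s) (F : S → A → ℝ) :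
    Fintype.card S * ∑ s : ι → S, F (s i) (h s) = ∑ s : ι → S, ∑ b : S, F b (h s) := by
  rw [← sum_update_eq (fun s => F (s i) (h s)) i]
  simp [hh]

/-! ### The batched strategy -/

section Batches

variable {V : Type u}

/-- The loss of playing `v` in round `t` if `v` was played in all rounds before. -/
def diagLoss (f : LossSequence V) (t : ℕ) (v : V) : ℝ := f.loss t (fun _ => v) v

theorem diagLoss_mem (f : LossSequence V) (t : ℕ) (v : V) :
    diagLoss f t v ∈ Set.Icc (0 : ℝ) 1 := f.loss_mem _ _ _

theorem loss_eq_diagLoss {f : LossSequence V} (hf : f.HasMemory 1) {T : ℕ} (x : Fin T → V)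
    {k : ℕ} (hk : k + 1 < T) {v : V} (hx : x ⟨k, k.lt_succ_self.trans hk⟩ = v) :
    f.loss (k + 1) (past x ⟨k + 1, hk⟩) v = diagLoss f (k + 1) v := by
  refine hf (k + 1) _ _ v fun s hs => ?_
  have h1 : (s : ℕ) = k := by have := s.2; omega
  rw [← hx]
  exact congrArg x (Fin.ext h1)

theorem perturbed_congr {L : ℕ} {l l' : ℕ → V → ℝ} (n : V → Fin L) {j : ℕ}
    (h : ∀ i < j, ∀ v, l i v = l' i v) : perturbed l n j = perturbed l' n j := by
  funext v
  unfold perturbed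
  rw [Finset.sum_congr rfl fun i hi => h i (Finset.mem_range.1 hi) v]

variable [Fintype V] [Nonempty V]

/-- A minimizer of `c`. -/
noncomputable def argmin (c : V → ℝ) : V := (Finite.exists_min c).choose

theorem argmin_le (c : V → ℝ) (v : V) : c (argmin c) ≤ c v := (Finite.exists_min c).choose_spec v

variable [DecidableEq V]

/-- The loss estimates of batch `j`, of length `b + 1`, from the quantized losses `z`. Only the
probed action `(σ j).1` is estimated, from the round after the probing position `(σ j).2`. -/
noncomputable def estimate (b : ℕ) (σ : ℕ → V × ℕ) (z : ℕ → V → ℤ) (j : ℕ) (v : V) : ℝ :=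
  if (σ j).1 = v then (z (j * (b + 1) + (σ j).2 + 1) v : ℝ) / b else 0

/-- The action in round `t`: the action to be probed at the probing position of a batch, its
observer thereafter, and the perturbed leader in all other rounds. -/
noncomputable def batchAction (w : V → V) (b : ℕ) {L : ℕ} (n : V → Fin L) (σ : ℕ → V × ℕ)
    (z : ℕ → V → ℤ) (t : ℕ) : V :=
  if t % (b + 1) = (σ (t / (b + 1))).2 then (σ (t / (b + 1))).1
  else if t % (b + 1) = (σ (t / (b + 1))).2 + 1 then w (σ (t / (b + 1))).1
  else argmin (perturbed (estimate b σ z) n (t / (b + 1)))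

variable {w : V → V} {b L : ℕ} {n : V → Fin L} {σ : ℕ → V × ℕ} {z : ℕ → V → ℤ}

theorem batch_div {s : ℕ} (hs : s < b + 1) (i : ℕ) : (i * (b + 1) + s) / (b + 1) = i := by
  rw [mul_comm, Nat.mul_add_div b.succ_pos, Nat.div_eq_of_lt hs, add_zero]

theorem batch_mod {s : ℕ} (hs : s < b + 1) (i : ℕ) : (i * (b + 1) + s) % (b + 1) = s := by
  rw [mul_comm, Nat.mul_add_mod, Nat.mod_eq_of_lt hs]

theorem batchAction_probe (hσ : ∀ i, (σ i).2 < b) (i : ℕ) :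
    batchAction w b n σ z (i * (b + 1) + (σ i).2) = (σ i).1 := by
  have h := (hσ i).trans b.lt_succ_self
  unfold batchAction
  rw [batch_div h, batch_mod h, if_pos rfl]

theorem batchAction_observe (hσ : ∀ i, (σ i).2 < b) (i : ℕ) :
    batchAction w b n σ z (i * (b + 1) + (σ i).2 + 1) = w (σ i).1 := by
  have h : (σ i).2 + 1 < b + 1 := Nat.succ_lt_succ (hσ i)
  unfold batchAction
  rw [add_assoc, batch_div h, batch_mod h, if_neg (Nat.succ_ne_self _), if_pos rfl]

theorem batchAction_exploit {i s : ℕ} (hs : s < b + 1) (h1 : s ≠ (σ i).2)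
    (h2 : s ≠ (σ i).2 + 1) :
    batchAction w b n σ z (i * (b + 1) + s) = argmin (perturbed (estimate b σ z) n i) := by
  unfold batchAction
  rw [batch_div hs, batch_mod hs, if_neg h1, if_neg h2]

/-- The batched strategy for given seeds. -/
noncomputable def batchStrategy (w : V → V) (b : ℕ) {L : ℕ} (n : V → Fin L) (σ : ℕ → V × ℕ) :
    Strategy V :=
  Strategy.quantized b fun t y => batchAction w b n σ (extendZero y) t

/-- The losses that the quantized estimates are based on. -/
noncomputable def quantizedLoss (f : LossSequence V) (b t : ℕ) (v : V) : ℤ := ⌊b * diagLoss f t v⌋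

/-- A leader uses only estimates of finished batches. There the round before the observation played
the probed action, so by memory 1 the loss shown by its observer is the diagonal one. Hence the play
is determined by `f` and the seeds alone. -/
theorem eq_batchAction_of_consistent {G : Digraph V} (hw : ∀ v, G.Adj (w v) v)
    {f : LossSequence V} (hf : f.HasMemory 1) (hσ : ∀ i, (σ i).2 < b) {T : ℕ} {x : Fin T → V}
    (hx : ∀ t, x t = batchAction w b n σ
      (extendZero fun s v => ⌊b * past (feedback G f x) t s v⌋) t) (t : Fin T) :
    x t = batchAction w b n σ (quantizedLoss f b) t := by
  rw [hx]
  unfold batchAction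
  congr 3
  refine perturbed_congr n fun i hi v => ?_
  unfold estimate
  split_ifs with hv
  · congr 2
    have hr : i * (b + 1) + (σ i).2 + 1 < t := by
      have h1 : (i + 1) * (b + 1) ≤ t :=
        (Nat.mul_le_mul_right _ hi).trans (Nat.div_mul_le_self _ _)
      have h2 := hσ i
      rw [add_mul, one_mul] at h1
      omega
    have hrT := hr.trans t.2
    have e1 : extendZero (fun (s : Fin t) v => ⌊(b : ℝ) * past (feedback G f x) t s v⌋)
        (i * (b + 1) + (σ i).2 + 1) v =
        ⌊(b : ℝ) * feedback G f x ⟨i * (b + 1) + (σ i).2 + 1, hrT⟩ v⌋ := by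
      rw [extendZero, dif_pos hr]
      rfl
    rw [e1, quantizedLoss]
    have hprobe : x ⟨i * (b + 1) + (σ i).2, by omega⟩ = v := by
      rw [hx, ← hv]
      exact batchAction_probe hσ i
    have hobs : x ⟨i * (b + 1) + (σ i).2 + 1, hrT⟩ = w v := by
      rw [hx, ← hv]
      exact batchAction_observe hσ i
    have hmem : v ∈ outNbhd G (x ⟨i * (b + 1) + (σ i).2 + 1, hrT⟩) := by
      rw [hobs]
      exact hw v
    rw [feedback, if_pos hmem, ← loss_eq_diagLoss hf x hrT hprobe]
  · rfl

theorem sum_range_mul_eq (h : ℕ → ℝ) (J B : ℕ) :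
    ∑ t ∈ Finset.range (J * B), h t =
      ∑ j ∈ Finset.range J, ∑ s ∈ Finset.range B, h (j * B + s) := by
  induction J with
  | zero => simp
  | succ J ih => rw [add_mul, one_mul, Finset.sum_range_add, ih, Finset.sum_range_succ]

/-- The loss of playing `v` throughout batch `j`, without the first round. -/
def batchLoss (f : LossSequence V) (b j : ℕ) (v : V) : ℝ :=
  ∑ s ∈ Finset.range b, diagLoss f (j * (b + 1) + (s + 1)) v

/-- The perturbed leader of batch `j`. -/
noncomputable def batchLeader (f : LossSequence V) (b : ℕ) {L : ℕ} (n : V → Fin L)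
    (σ : ℕ → V × ℕ) (j : ℕ) : V :=
  argmin (perturbed (estimate b σ (quantizedLoss f b)) n j)

/-- A round has the diagonal loss of the leader if the leader was played in it and just before. This
can fail only at the first round of the batch, the probe, the observation and the round after it,
whence the 4. -/
theorem batch_loss_le {f : LossSequence V} (hf : f.HasMemory 1) {T : ℕ} {x : Fin T → V}
    (hx : ∀ t, x t = batchAction w b n σ (quantizedLoss f b) t) {j : ℕ}
    (hj : (j + 1) * (b + 1) ≤ T) {ℓ : ℕ → ℝ} (hℓ1 : ∀ t, ℓ t ≤ 1)
    (hℓ : ∀ t : Fin T, ℓ t = f.loss t (past x t) (x t)) :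
    ∑ s ∈ Finset.range (b + 1), ℓ (j * (b + 1) + s) ≤
      batchLoss f b j (batchLeader f b n σ j) + 4 := by
  set τ := (σ j).2 with hτ
  set a := batchLeader f b n σ j with ha
  have hs : ∀ s ∈ Finset.range b, ℓ (j * (b + 1) + (s + 1)) ≤
      diagLoss f (j * (b + 1) + (s + 1)) a + ((if s = τ then 1 else 0) +
        (if s + 1 = τ then 1 else 0) + (if s = τ + 1 then 1 else 0)) := by
    intro s hs
    have hsb := Finset.mem_range.1 hs
    have hd := (diagLoss_mem f (j * (b + 1) + (s + 1)) a).1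
    have h1 := hℓ1 (j * (b + 1) + (s + 1))
    by_cases c1 : s = τ
    · rw [if_pos c1]
      split_ifs <;> linarith
    by_cases c2 : s + 1 = τ
    · rw [if_pos c2]
      split_ifs <;> linarith
    by_cases c3 : s = τ + 1
    · rw [if_neg c1, if_neg c2, if_pos c3]
      linarith
    rw [if_neg c1, if_neg c2, if_neg c3]
    have hT : j * (b + 1) + s + 1 < T := by
      rw [add_mul, one_mul] at hj
      omega
    have x1 : x ⟨j * (b + 1) + s, by omega⟩ = a := by
      rw [hx]
      exact batchAction_exploit (by omega) c1 c3
    have x2 : x ⟨j * (b + 1) + s + 1, hT⟩ = a := by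
      rw [hx]
      exact batchAction_exploit (s := s + 1) (by omega) c2 (fun h => c1 (by omega))
    have h2 := hℓ ⟨j * (b + 1) + s + 1, hT⟩
    rw [x2] at h2
    have h3 := loss_eq_diagLoss hf x hT x1
    have h4 : ℓ (j * (b + 1) + (s + 1)) = diagLoss f (j * (b + 1) + (s + 1)) a :=
      h2.trans h3
    rw [h4]
    linarith
  rw [Finset.sum_range_succ']
  have hsum := Finset.sum_le_sum hs
  simp only [Finset.sum_add_distrib] at hsum
  have i1 : ∑ s ∈ Finset.range b, (if s = τ then (1 : ℝ) else 0) ≤ 1 := by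
    rw [Finset.sum_ite_eq']
    split_ifs <;> simp
  have i2 : ∑ s ∈ Finset.range b, (if s + 1 = τ then (1 : ℝ) else 0) ≤ 1 := by
    calc _ ≤ ∑ s ∈ Finset.range b, (if s = τ - 1 then (1 : ℝ) else 0) := by
          refine Finset.sum_le_sum fun s _ => ?_
          by_cases h : s + 1 = τ
          · rw [if_pos h, if_pos (by omega)]
          · rw [if_neg h]
            split_ifs <;> simp
      _ ≤ 1 := by
          rw [Finset.sum_ite_eq']
          split_ifs <;> simp
  have i3 : ∑ s ∈ Finset.range b, (if s = τ + 1 then (1 : ℝ) else 0) ≤ 1 := by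
    rw [Finset.sum_ite_eq']
    split_ifs <;> simp
  have h0 := hℓ1 (j * (b + 1) + 0)
  unfold batchLoss
  linarith

/-- Besides the waste of 4 per batch, the incomplete last batch costs at most its length `r`. For
the comparator, nonnegativity allows dropping these rounds and the first round of each batch. -/
theorem policyRegret_le_of_batchAction {f : LossSequence V} (hf : f.HasMemory 1) {J r : ℕ}
    {x : Fin (J * (b + 1) + r) → V}
    (hx : ∀ t, x t = batchAction w b n σ (quantizedLoss f b) t) {v : V}
    (hv : ∀ a, ∑ t : Fin (J * (b + 1) + r), diagLoss f t v ≤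
      ∑ t : Fin (J * (b + 1) + r), diagLoss f t a) :
    policyRegret f x ≤ ∑ j ∈ Finset.range J, batchLoss f b j (batchLeader f b n σ j) -
      ∑ j ∈ Finset.range J, batchLoss f b j v + 4 * J + r := by
  have hinf : ∑ t : Fin (J * (b + 1) + r), diagLoss f t v ≤
      ⨅ a : V, ∑ t : Fin (J * (b + 1) + r), f.loss t (fun _ => a) a := le_ciInf hv
  have hcmp : ∑ j ∈ Finset.range J, batchLoss f b j v ≤
      ∑ t : Fin (J * (b + 1) + r), diagLoss f t v := by
    rw [Fin.sum_univ_eq_sum_range (fun t => diagLoss f t v), Finset.sum_range_add,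
      sum_range_mul_eq]
    have h1 : 0 ≤ ∑ s ∈ Finset.range r, diagLoss f (J * (b + 1) + s) v :=
      Finset.sum_nonneg fun s _ => (diagLoss_mem _ _ _).1
    refine le_trans (Finset.sum_le_sum fun j _ => ?_) (le_add_of_nonneg_right h1)
    rw [Finset.sum_range_succ', batchLoss]
    exact le_add_of_nonneg_right (diagLoss_mem _ _ _).1
  set ℓ : ℕ → ℝ := fun t =>
    if h : t < J * (b + 1) + r then f.loss t (past x ⟨t, h⟩) (x ⟨t, h⟩) else 0 with hℓdef
  have hℓ1 : ∀ t, ℓ t ≤ 1 := by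
    intro t
    simp only [hℓdef]
    split_ifs
    · exact (f.loss_mem _ _ _).2
    · exact zero_le_one
  have hℓ : ∀ t : Fin (J * (b + 1) + r), ℓ t = f.loss t (past x t) (x t) := fun t =>
    dif_pos t.2
  have hloss : ∑ t : Fin (J * (b + 1) + r), f.loss t (past x t) (x t) ≤
      ∑ j ∈ Finset.range J, batchLoss f b j (batchLeader f b n σ j) + 4 * J + r := by
    simp only [← hℓ]
    rw [Fin.sum_univ_eq_sum_range ℓ, Finset.sum_range_add, sum_range_mul_eq]
    refine add_le_add ?_ ?_
    · calc _ ≤ ∑ j ∈ Finset.range J, (batchLoss f b j (batchLeader f b n σ j) + 4) := by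
            refine Finset.sum_le_sum fun j hj => batch_loss_le hf hx ?_ hℓ1 hℓ
            have := Finset.mem_range.1 hj
            exact (Nat.mul_le_mul_right _ this).trans (Nat.le_add_right _ _)
        _ = _ := by
            rw [Finset.sum_add_distrib]
            simp [mul_comm]
    · calc _ ≤ ∑ _s ∈ Finset.range r, (1 : ℝ) := Finset.sum_le_sum fun s _ => hℓ1 _
        _ = r := by simp
  unfold policyRegret
  linarith

/-! ### The regret of the batched strategy -/

/-- The seeds of the batches, continued arbitrarily after the last batch. -/
noncomputable def extendSeeds {J : ℕ} (s : Fin J → V × Fin b) (j : ℕ) : V × ℕ :=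
  if h : j < J then ((s ⟨j, h⟩).1, (s ⟨j, h⟩).2) else (Classical.arbitrary V, 0)

omit [Fintype V] [DecidableEq V] in
theorem extendSeeds_lt (hb : 0 < b) {J : ℕ} (s : Fin J → V × Fin b) (j : ℕ) :
    (extendSeeds s j).2 < b := by
  unfold extendSeeds
  split_ifs
  · exact Fin.is_lt _
  · exact hb

/-- The estimates of batch `j` as a function of the seed of this batch. -/
noncomputable def seedEstimate (f : LossSequence V) (b j : ℕ) (s : V × Fin b) (v : V) : ℝ :=
  if s.1 = v then (quantizedLoss f b (j * (b + 1) + s.2 + 1) v : ℝ) / b else 0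

omit [Fintype V] in
theorem estimate_extendSeeds (f : LossSequence V) {J : ℕ} (s : Fin J → V × Fin b) (j : Fin J)
    (v : V) :
    estimate b (extendSeeds s) (quantizedLoss f b) j v = seedEstimate f b j (s j) v := by
  simp [estimate, seedEstimate, extendSeeds]

omit [Fintype V] [Nonempty V] in
theorem estimate_mem (hb : 0 < b) (f : LossSequence V) (σ : ℕ → V × ℕ) (j : ℕ) (v : V) :
    estimate b σ (quantizedLoss f b) j v ∈ Set.Icc (0 : ℝ) 1 := by
  have hb0 : (0 : ℝ) < b := by exact_mod_cast hb
  unfold estimate quantizedLoss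
  have h := diagLoss_mem f (j * (b + 1) + (σ j).2 + 1) v
  split_ifs
  · refine ⟨div_nonneg ?_ hb0.le, (div_le_one hb0).2 ((Int.floor_le _).trans ?_)⟩
    · exact_mod_cast Int.floor_nonneg.2 (mul_nonneg hb0.le h.1)
    · nlinarith [h.2]
  · simp

omit [Nonempty V] in
theorem sum_seedEstimate (f : LossSequence V) (b j : ℕ) (v : V) :
    ∑ s : V × Fin b, seedEstimate f b j s v =
      ∑ s ∈ Finset.range b, (quantizedLoss f b (j * (b + 1) + s + 1) v : ℝ) / b := by
  rw [Fintype.sum_prod_type_right,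
    ← Fin.sum_univ_eq_sum_range (fun s => (quantizedLoss f b (j * (b + 1) + s + 1) v : ℝ) / b)]
  refine Finset.sum_congr rfl fun s _ => ?_
  simp [seedEstimate]

omit [Nonempty V] in
theorem sum_seedEstimate_le (hb : 0 < b) (f : LossSequence V) (j : ℕ) (v : V) :
    ∑ s : V × Fin b, seedEstimate f b j s v ≤ batchLoss f b j v := by
  have hb0 : (0 : ℝ) < b := by exact_mod_cast hb
  rw [sum_seedEstimate]
  refine Finset.sum_le_sum fun s _ => ?_
  rw [div_le_iff₀' hb0]
  exact Int.floor_le ((b : ℝ) * diagLoss f (j * (b + 1) + s + 1) v)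

omit [Nonempty V] in
theorem batchLoss_le_sum_seedEstimate (hb : 0 < b) (f : LossSequence V) (j : ℕ) (v : V) :
    batchLoss f b j v ≤ ∑ s : V × Fin b, seedEstimate f b j s v + 1 := by
  have hb0 : (0 : ℝ) < b := by exact_mod_cast hb
  rw [sum_seedEstimate]
  calc batchLoss f b j v ≤ ∑ s ∈ Finset.range b,
        ((quantizedLoss f b (j * (b + 1) + s + 1) v : ℝ) / b + 1 / b) := by
        refine Finset.sum_le_sum fun s _ => ?_
        rw [← add_div, le_div_iff₀' hb0]
        exact (Int.lt_floor_add_one _).le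
    _ = _ := by
        rw [Finset.sum_add_distrib]
        simp [hb0.ne']

/-- The leader of a batch is chosen from earlier seeds, hence is independent of the seed of its own
batch. -/
theorem batchLeader_update (f : LossSequence V) (n : V → Fin L) {J : ℕ} (s : Fin J → V × Fin b)
    (j : Fin J) (c : V × Fin b) :
    batchLeader f b n (extendSeeds (Function.update s j c)) j =
      batchLeader f b n (extendSeeds s) j := by
  unfold batchLeader
  congr 1
  refine perturbed_congr n fun i hi v => ?_
  have hiJ : i < J := hi.trans j.2
  have h1 := estimate_extendSeeds f (Function.update s j c) ⟨i, hiJ⟩ v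
  have h2 := estimate_extendSeeds f s ⟨i, hiJ⟩ v
  have hne : (⟨i, hiJ⟩ : Fin J) ≠ j := fun h => hi.ne (congrArg Fin.val h)
  rw [Function.update_of_ne hne, ← h2] at h1
  exact h1

/-- The total loss of the perturbed leaders over all seeds. -/
theorem sum_batchLoss_leader_le (hb : 0 < b) (hL : 0 < L) (f : LossSequence V) (J : ℕ) (v : V) :
    ∑ n : V → Fin L, ∑ s : Fin J → V × Fin b,
      ∑ j ∈ Finset.range J, batchLoss f b j (batchLeader f b n (extendSeeds s) j) ≤
    Fintype.card (V → Fin L) * (Fintype.card (Fin J → V × Fin b) *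
      (∑ j ∈ Finset.range J, batchLoss f b j v +
        Fintype.card V * b * (L + 2 * Fintype.card V * J / L) + J)) := by
  set K : ℝ := (Fintype.card (V × Fin b) : ℝ) with hK
  set N : ℝ := (Fintype.card (V → Fin L) : ℝ) with hN
  set C : ℝ := (Fintype.card (Fin J → V × Fin b) : ℝ) with hC
  have hK0 : 0 ≤ K := Nat.cast_nonneg _
  have hN0 : 0 ≤ N := Nat.cast_nonneg _
  have hC0 : 0 ≤ C := Nat.cast_nonneg _
  -- Averaging over the independent seed of batch `j` turns `K` times the estimate into the rounded
  -- batch loss; rounding costs at most `b * (1 / b) = 1` per batch.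
  have hleader : ∀ (n : V → Fin L) (j : Fin J),
      ∑ s : Fin J → V × Fin b, batchLoss f b j (batchLeader f b n (extendSeeds s) j) ≤
        K * ∑ s : Fin J → V × Fin b, estimate b (extendSeeds s) (quantizedLoss f b) j
          (batchLeader f b n (extendSeeds s) j) + C := by
    intro n j
    have h1 := sum_apply_eq_of_update j
      (fun s : Fin J → V × Fin b => batchLeader f b n (extendSeeds s) j)
      (fun s c => batchLeader_update f n s j c) (seedEstimate f b j)
    simp only [estimate_extendSeeds]
    rw [h1]
    calc _ ≤ ∑ s : Fin J → V × Fin b, (∑ c, seedEstimate f b j c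
          (batchLeader f b n (extendSeeds s) j) + 1) :=
          Finset.sum_le_sum fun s _ => batchLoss_le_sum_seedEstimate hb f j _
      _ = _ := by
          rw [Finset.sum_add_distrib]
          simp [hC]
  -- For the fixed comparator, rounding down goes in the favourable direction.
  have hcomp : ∀ j : Fin J,
      K * ∑ s : Fin J → V × Fin b, estimate b (extendSeeds s) (quantizedLoss f b) j v ≤
        C * batchLoss f b j v := by
    intro j
    have h1 := sum_apply_eq_of_update j (fun _ : Fin J → V × Fin b => v)
      (fun s c => rfl) (seedEstimate f b j)
    simp only [estimate_extendSeeds]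
    rw [h1, Finset.sum_const, Finset.card_univ, nsmul_eq_mul]
    exact mul_le_mul_of_nonneg_left (sum_seedEstimate_le hb f j v) hC0
  have hfpl : ∀ s : Fin J → V × Fin b,
      ∑ n : V → Fin L, ∑ j ∈ Finset.range J, estimate b (extendSeeds s) (quantizedLoss f b) j
          (batchLeader f b n (extendSeeds s) j) ≤
        N * (∑ j ∈ Finset.range J, estimate b (extendSeeds s) (quantizedLoss f b) j v + L +
          2 * Fintype.card V * J / L) := fun s =>
    sum_perturbed_leader_le hL argmin_le _ (fun j v => estimate_mem hb f _ j v) J v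
  have hKeq : K = Fintype.card V * b := by
    rw [hK, Fintype.card_prod, Fintype.card_fin]
    push_cast
    rfl
  calc _ = ∑ n : V → Fin L, ∑ j : Fin J, ∑ s : Fin J → V × Fin b,
        batchLoss f b j (batchLeader f b n (extendSeeds s) j) := by
        refine Finset.sum_congr rfl fun n _ => ?_
        rw [Finset.sum_comm, ← Fin.sum_univ_eq_sum_range (fun j => ∑ s : Fin J → V × Fin b,
          batchLoss f b j (batchLeader f b n (extendSeeds s) j))]
    _ ≤ ∑ n : V → Fin L, ∑ j : Fin J,
        (K * ∑ s : Fin J → V × Fin b, estimate b (extendSeeds s) (quantizedLoss f b) j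
          (batchLeader f b n (extendSeeds s) j) + C) :=
        Finset.sum_le_sum fun n _ => Finset.sum_le_sum fun j _ => hleader n j
    _ = K * ∑ s : Fin J → V × Fin b, ∑ n : V → Fin L, ∑ j ∈ Finset.range J,
          estimate b (extendSeeds s) (quantizedLoss f b) j
            (batchLeader f b n (extendSeeds s) j) + N * (J * C) := by
        rw [Finset.sum_comm (s := (Finset.univ : Finset (Fin J → V × Fin b)))]
        simp only [Finset.sum_add_distrib, ← Finset.mul_sum]
        congr 1
        · congr 1
          refine Finset.sum_congr rfl fun n _ => ?_
          rw [Finset.sum_comm (s := (Finset.univ : Finset (Fin J → V × Fin b))),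
            ← Fin.sum_univ_eq_sum_range (fun j => ∑ s : Fin J → V × Fin b,
              estimate b (extendSeeds s) (quantizedLoss f b) j
                (batchLeader f b n (extendSeeds s) j))]
        · simp [hN]
    _ ≤ K * ∑ s : Fin J → V × Fin b,
          N * (∑ j ∈ Finset.range J, estimate b (extendSeeds s) (quantizedLoss f b) j v + L +
            2 * Fintype.card V * J / L) + N * (J * C) :=
        add_le_add (mul_le_mul_of_nonneg_left (Finset.sum_le_sum fun s _ => hfpl s) hK0) le_rfl
    _ = N * (∑ j : Fin J, K * ∑ s : Fin J → V × Fin b,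
          estimate b (extendSeeds s) (quantizedLoss f b) j v) +
        N * (C * (K * (L + 2 * Fintype.card V * J / L) + J)) := by
        rw [← Finset.mul_sum, ← Finset.mul_sum]
        simp only [Finset.sum_add_distrib, Finset.sum_const, Finset.card_univ, nsmul_eq_mul]
        rw [Finset.sum_comm, ← Fin.sum_univ_eq_sum_range (fun j => ∑ s : Fin J → V × Fin b,
          estimate b (extendSeeds s) (quantizedLoss f b) j v)]
        simp only [← hC]
        ring
    _ ≤ N * (∑ j : Fin J, C * batchLoss f b j v) +
        N * (C * (K * (L + 2 * Fintype.card V * J / L) + J)) :=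
        add_le_add (mul_le_mul_of_nonneg_left (Finset.sum_le_sum fun j _ => hcomp j) hN0) le_rfl
    _ = _ := by
        rw [← Finset.mul_sum, Fin.sum_univ_eq_sum_range (fun j => batchLoss f b j v), hKeq]
        ring

/-- The regret of the uniform mixture of batched strategies. -/
theorem expectedRegret_batch_mixture_le {G : Digraph V} (hw : ∀ v, G.Adj (w v) v) (hb : 0 < b)
    (hL : 0 < L) (J r : ℕ) [Nonempty ((V → Fin L) × (Fin J → V × Fin b))] {f : LossSequence V}
    (hf : f.HasMemory 1) :
    expectedRegret G (Strategy.mixture fun ω : (V → Fin L) × (Fin J → V × Fin b) =>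
        batchStrategy w b ω.1 (extendSeeds ω.2)) f (J * (b + 1) + r) ≤
      Fintype.card V * b * (L + 2 * Fintype.card V * J / L) + 5 * J + r := by
  obtain ⟨v, hv⟩ := Finite.exists_min fun a : V =>
    ∑ t : Fin (J * (b + 1) + r), diagLoss f t a
  have h1 : ∀ ω : (V → Fin L) × (Fin J → V × Fin b),
      expectedRegret G (batchStrategy w b ω.1 (extendSeeds ω.2)) f (J * (b + 1) + r) ≤
        ∑ j ∈ Finset.range J, batchLoss f b j (batchLeader f b ω.1 (extendSeeds ω.2) j) +
          (4 * J + r - ∑ j ∈ Finset.range J, batchLoss f b j v) := by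
    intro ω
    refine expectedRegret_quantized_le G b _ f fun x hx => ?_
    have hx' := eq_batchAction_of_consistent hw hf (extendSeeds_lt hb ω.2) hx
    have := policyRegret_le_of_batchAction hf hx' hv
    linarith
  have hcard : (0 : ℝ) < Fintype.card ((V → Fin L) × (Fin J → V × Fin b)) := by
    exact_mod_cast Fintype.card_pos
  rw [expectedRegret_mixture, div_le_iff₀ hcard]
  refine (Finset.sum_le_sum fun ω _ => h1 ω).trans ?_
  rw [Finset.sum_add_distrib, Fintype.sum_prod_type, Finset.sum_const, Finset.card_univ,
    nsmul_eq_mul, Fintype.card_prod]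
  have h2 := sum_batchLoss_leader_le hb hL f J v
  push_cast
  linarith

end Batches

/-! ### Observers and choice of parameters in the upper bound -/

theorem IsStronglyObservable.exists_observer {V : Type u} [Fintype V] {G : Digraph V}
    (hG : IsStronglyObservable G) (hV : 2 ≤ Fintype.card V) :
    ∃ w : V → V, ∀ v, G.Adj (w v) v := by
  have h : ∀ v, ∃ u, G.Adj u v := by
    intro v
    rcases hG v with h | h
    · exact ⟨v, h (Set.mem_singleton v)⟩
    · have : Nontrivial V := Fintype.one_lt_card_iff_nontrivial.1 hV
      obtain ⟨u, hu⟩ := exists_ne v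
      exact ⟨u, h ⟨Set.mem_univ u, hu⟩⟩
  exact ⟨fun v => (h v).choose, fun v => (h v).choose_spec⟩

theorem minimaxRegret_upper_bound {V : Type u} [Fintype V] [Nonempty V] {G : Digraph V}
    {w : V → V} (hw : ∀ v, G.Adj (w v) v) {T : ℕ} (hT : 1 ≤ T) :
    minimaxRegret G 1 T ≤
      (4 * Fintype.card V + 2 * (Fintype.card V : ℝ) ^ 2 + 7) * (T : ℝ) ^ ((2 : ℝ) / 3) := by
  classical
  have hTpos : (0 : ℝ) ≤ T := Nat.cast_nonneg T
  rw [rpow_two_thirds hTpos]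
  set x := (T : ℝ) ^ ((1 : ℝ) / 3) with hx
  have hx3 : x ^ 3 = T := rpow_one_third_pow hTpos
  have hx1 : 1 ≤ x := Real.one_le_rpow (by exact_mod_cast hT) (by norm_num)
  set b := ⌈x⌉₊ with hb
  have hb1 : x ≤ b := Nat.le_ceil x
  have hb2 : (b : ℝ) ≤ 2 * x := by linarith [Nat.ceil_lt_add_one (by linarith : 0 ≤ x)]
  have hb0 : 0 < b := by exact_mod_cast (by linarith : (0 : ℝ) < b)
  obtain ⟨J, r, hJr, hr⟩ : ∃ J r, T = J * (b + 1) + r ∧ r ≤ b :=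
    ⟨T / (b + 1), T % (b + 1), (Nat.div_add_mod' T (b + 1)).symm,
      Nat.lt_succ_iff.1 (Nat.mod_lt _ b.succ_pos)⟩
  have hr' : (r : ℝ) ≤ 2 * x ^ 2 := by
    have : (r : ℝ) ≤ b := by exact_mod_cast hr
    nlinarith
  have hJ : (J : ℝ) ≤ x ^ 2 := by
    have h1 : (T : ℝ) = J * (b + 1) + r := by exact_mod_cast hJr
    have h2 : (J : ℝ) * x ≤ x ^ 2 * x := by
      have h3 : (J : ℝ) * x ≤ J * (b + 1) :=
        mul_le_mul_of_nonneg_left (by linarith) (Nat.cast_nonneg J)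
      have h4 : (0 : ℝ) ≤ r := Nat.cast_nonneg r
      linarith [hx3, pow_succ x 2]
    exact le_of_mul_le_mul_right h2 (by linarith)
  have : Nonempty (Fin b) := ⟨⟨0, hb0⟩⟩
  -- Noise range and batch length are both `b`, near `T ^ (1/3)`. Then the leader's regret, scaled
  -- by `|V| * b`, is `|V| * b ^ 2 + 2 * |V| ^ 2 * J`, of the same order as the waste `5 * J`.
  refine minimaxRegret_le G (Strategy.mixture fun ω : (V → Fin b) × (Fin J → V × Fin b) =>
    batchStrategy w b ω.1 (extendSeeds ω.2)) fun f hf => ?_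
  have h := expectedRegret_batch_mixture_le hw hb0 hb0 J r hf
  rw [← hJr] at h
  refine h.trans ?_
  set K : ℝ := (Fintype.card V : ℝ) with hK
  have hK0 : 0 ≤ K := Nat.cast_nonneg _
  have hbR : (0 : ℝ) < b := by linarith
  have e1 : K * b * (b + 2 * K * J / b) = K * (b : ℝ) ^ 2 + 2 * K ^ 2 * J := by
    field_simp
  have e2 : (b : ℝ) ^ 2 ≤ 4 * x ^ 2 := by nlinarith
  have e3 := mul_le_mul_of_nonneg_left e2 hK0
  have e4 := mul_le_mul_of_nonneg_left hJ (by positivity : 0 ≤ 2 * K ^ 2)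
  rw [e1]
  linarith

end GraphGame

theorem mainTheorem4 :
    (∃ c : ℝ, 0 < c ∧ ∃ p T₀ : ℕ,
      ∀ (V : Type u) [Fintype V] (G : Digraph V),
        2 ≤ Fintype.card V → GraphGame.IsStronglyObservable G →
          ∀ T : ℕ, T₀ ≤ T →
            c * (T : ℝ) ^ ((2 : ℝ) / 3) / Real.log T ^ p ≤ GraphGame.minimaxRegret G 1 T) ∧
    (∀ (V : Type u) [Fintype V] (G : Digraph V),
      2 ≤ Fintype.card V → GraphGame.IsStronglyObservable G →
        ∃ C : ℝ, 0 < C ∧ ∃ p T₀ : ℕ, ∀ T : ℕ, T₀ ≤ T →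
          GraphGame.minimaxRegret G 1 T ≤ C * (T : ℝ) ^ ((2 : ℝ) / 3) * Real.log T ^ p) := by
  refine ⟨?_, fun V _ G hV hG => ?_⟩
  · obtain ⟨c, hc, T₀, h⟩ := GraphGame.exists_minimaxRegret_lower_bound.{u}
    refine ⟨c, hc, 1, T₀, fun V _ G hV _ T hT => ?_⟩
    rw [pow_one]
    exact h V G hV T hT
  · obtain ⟨w, hw⟩ := hG.exists_observer hV
    have : Nonempty V := Fintype.card_pos_iff.1 (by omega)
    refine ⟨4 * Fintype.card V + 2 * (Fintype.card V : ℝ) ^ 2 + 7, by positivity, 0, 1,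
      fun T hT => ?_⟩
    rw [pow_zero, mul_one]
    exact GraphGame.minimaxRegret_upper_bound hw hT
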